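/- Let $\Lambda_{\rm GM}=A_1^{\oplus 2}\oplus E_8^{\oplus 2}\oplus U^{\oplus 2}$, an even lattice of signature $(20,2)$. Let $e,f$ be the standard generators of $A_1^{\oplus 2}$ (so $\langle e,e\rangle=\langle f,f\rangle=2$, $\langle e,f\rangle=0$), and put $e_*=\tfrac12 e$, $f_*=\tfrac12 f\in\Lambda_{\rm GM}^\vee$; the discriminant group is $D(\Lambda_{\rm GM})=\Lambda_{\rm GM}^\vee/\Lambda_{\rm GM}=\{0,e_*,f_*,e_*+f_*\}$. Let $$\Omega=\{w\in\mathbb P(\Lambda_{\rm GM}\otimes\mathbb C)\mid \langle w,w\rangle=0,\ \langle w,\overline w\rangle<0\},$$ let $\Gamma\subset {\rm O}(\Lambda_{\rm GM})$ be the subgroup of isometries acting trivially on $D(\Lambda_{\rm GM})$, and let $\mathcal D=\Omega/\Gamma$. For $n\in\mathbb Q_{>0}$ and $\gamma\in D(\Lambda_{\rm GM})$, the (support of the) Heegner divisor $Y_{n,\gamma}\subset\mathcal D$ is the image of the union of the hyperplane sections $v^\perp=\{w\in\Omega\mid\langle v,w\rangle=0\}$ over all $v\in\Lambda_{\rm GM}^\vee$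 with $v\equiv\gamma \pmod{\Lambda_{\rm GM}}$ and $\tfrac12\langle v,v\rangle=n$. Let $L=\langle1\rangle^{\oplus22}\oplus\langle-1\rangle^{\oplus2}$ (the lattice $H^4(X,\mathbb Z)$ of a Gushel--Mukai fourfold $X$), let $h_1,h_2\in L$ satisfy $\langle h_i,h_j\rangle=2\delta_{ij}$, and fix an isometry of $\Lambda_{\rm GM}$ with the orthogonal complement $\{h_1,h_2\}^\perp\subset L$. A labelling is a primitive sublattice $K\subset L$ of rank three containing $h_1,h_2$. For a positive integer $d$, let $K_d=\langle h_1,h_2,\zeta\rangle$ (if $d\equiv0$ or $4$ mod $8$), respectively $K_d'=\langle h_1,h_2,\zeta'\rangle$ and $K_d''=\langle h_1,h_2,\zeta''\rangle$ (if $d\equiv2$ mod $8$), be any labellings with Gram matrices $$K_d:\begin{pmatrix}2&0&0\\0&2&0\\0&0&\frac d4\end{pmatrix}\ (d\equiv0),\qquad K_d:\begin{pmatrix}2&0&1\\0&2&1\\1&1&\frac{d+4}4\end{pmatrix}\ (d\equiv4),$$ $$K_d':\begin{pmatrix}2&0&1\\0&2&0\\1&0&\frac{d+2}4\end{pmatrix},\qquad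 K_d'':\begin{pmatrix}2&0&0\\0&2&1\\0&1&\frac{d+2}4\end{pmatrix}\ (d\equiv2),$$ and let $\mathcal D_d,\mathcal D_d',\mathcal D_d''\subset\mathcal D$ be the images of $\{w\in\Omega\mid w\perp K\}$ for $K=K_d,K_d',K_d''$ respectively. Then, after possibly exchanging the names of $e_*$ and $f_*$ (once, independently of $d$ and of the labellings), for every positive integer $d$: $$\mathcal D_d\subset Y_{\frac d8,0}\ \text{ if } d\equiv0\ (\mathrm{mod}\ 8),$$ $$\mathcal D_d'\subset Y_{\frac d8,e_*}\ \text{ and }\ \mathcal D_d''\subset Y_{\frac d8,f_*}\ \text{ if } d\equiv2\ (\mathrm{mod}\ 8),$$ $$\mathcal D_d\subset Y_{\frac d8,e_*+f_*}\ \text{ if } d\equiv4\ (\mathrm{mod}\ 8),$$ and in each case the left-hand side is an irreducible component of the right-hand side, i.e. a maximal irreducible closed analytic subset of $\mathcal D$ contained in it (a subset of $\mathcal D$ being closed analytic when its preimage in $\Omega$ is). -/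

import Mathlib

open scoped LinearAlgebra.Projectivization Matrix MatrixGroups

noncomputable section

namespace GushelMukai

/-! ### Lattices, dual lattices, discriminant groups, monodromy groups

A lattice is given by the Gram matrix `G : Matrix ι ι ℤ` of a `ℤ`-basis: the lattice is
`M = ι → ℤ`, and `M ⊗ ℚ = ι → ℚ`, `M ⊗ ℂ = ι → ℂ`. -/

section Lattice

set_option linter.unusedSectionVars false

variable {ι : Type} [Fintype ι] [DecidableEq ι]

/-- The `R`-bilinear extension of the intersection pairing of the lattice to `M ⊗ R`. -/
def pairing {R : Type} [CommRing R] (G : Matrix ι ι ℤ) (x y : ι → R) : R :=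
  x ⬝ᵥ (G.map (Int.cast : ℤ → R) *ᵥ y)

/-- The dual lattice `M^∨ = {v ∈ M ⊗ ℚ | ⟨v, m⟩ ∈ ℤ for all m ∈ M}`. -/
def dualLattice (G : Matrix ι ι ℤ) : AddSubgroup (ι → ℚ) where
  carrier := {v | ∀ m : ι → ℤ, ∃ k : ℤ, pairing G v (fun i => (m i : ℚ)) = k}
  zero_mem' := fun m => ⟨0, by simp [pairing]⟩
  add_mem' := by
    intro a b ha hb m
    obtain ⟨k, hk⟩ := ha m
    obtain ⟨l, hl⟩ := hb m
    refine ⟨k + l, ?_⟩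
    simp only [pairing] at hk hl
    simp [pairing, add_dotProduct, hk, hl]
  neg_mem' := by
    intro a ha m
    obtain ⟨k, hk⟩ := ha m
    refine ⟨-k, ?_⟩
    simp only [pairing] at hk
    simp [pairing, neg_dotProduct, hk]

/-- The lattice `M` itself, as a subgroup of `M ⊗ ℚ`. -/
def integralVectors (ι : Type) : AddSubgroup (ι → ℚ) where
  carrier := {v | ∃ m : ι → ℤ, v = fun i => (m i : ℚ)}
  zero_mem' := ⟨0, by ext; simp⟩
  add_mem' := by
    rintro _ _ ⟨m, rfl⟩ ⟨n, rfl⟩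
    exact ⟨m + n, by ext; simp⟩
  neg_mem' := by
    rintro _ ⟨m, rfl⟩
    exact ⟨-m, by ext; simp⟩

/-- The discriminant group `D(M) = M^∨ / M`. -/
abbrev DiscriminantGroup (G : Matrix ι ι ℤ) : Type :=
  dualLattice G ⧸ (integralVectors ι).addSubgroupOf (dualLattice G)

/-- The class in `D(M)` of a vector of `M^∨`. -/
def discriminantClass (G : Matrix ι ι ℤ) (v : dualLattice G) : DiscriminantGroup G :=
  QuotientAddGroup.mk v

/-- The action of an automorphism of the `ℤ`-module `M` on `M ⊗ R`. -/
def act {R : Type} [CommRing R] (g : GL ι ℤ) (x : ι → R) : ι → R :=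
  (g : Matrix ι ι ℤ).map (Int.cast : ℤ → R) *ᵥ x

theorem act_one {R : Type} [CommRing R] (x : ι → R) : act (1 : GL ι ℤ) x = x := by
  simp [act]

theorem act_mul {R : Type} [CommRing R] (g h : GL ι ℤ) (x : ι → R) :
    act (g * h) x = act g (act h x) := by
  have : ((g * h : GL ι ℤ) : Matrix ι ι ℤ).map (Int.cast : ℤ → R)
      = (g : Matrix ι ι ℤ).map (Int.cast : ℤ → R) * (h : Matrix ι ι ℤ).map Int.cast := by
    rw [Units.val_mul]
    exact Matrix.map_mul (f := Int.castRingHom R)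
  rw [act, this, act, act, Matrix.mulVec_mulVec]

theorem act_sub {R : Type} [CommRing R] (g : GL ι ℤ) (x y : ι → R) :
    act g (x - y) = act g x - act g y := Matrix.mulVec_sub _ _ _

theorem act_mem_integralVectors (g : GL ι ℤ) {v : ι → ℚ} (hv : v ∈ integralVectors ι) :
    act g v ∈ integralVectors ι := by
  obtain ⟨m, rfl⟩ := hv
  refine ⟨(g : Matrix ι ι ℤ) *ᵥ m, ?_⟩
  ext i
  simp [act, Matrix.mulVec, dotProduct]

/-- The monodromy group `Γ_M = {g ∈ O(M) | g acts trivially on D(M)}`; membership in `O(M)` is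
the matrix identity `gᵀ G g = G`. -/
def monodromyGroup (G : Matrix ι ι ℤ) : Subgroup (GL ι ℤ) where
  carrier := {g | (g : Matrix ι ι ℤ)ᵀ * G * (g : Matrix ι ι ℤ) = G ∧
    ∀ v ∈ dualLattice G, act g v - v ∈ integralVectors ι}
  one_mem' := ⟨by simp, fun v _ => by rw [act_one, sub_self]; exact zero_mem _⟩
  mul_mem' := by
    rintro g h ⟨hg, hg'⟩ ⟨hh, hh'⟩
    refine ⟨?_, fun v hv => ?_⟩
    · calc ((g * h : GL ι ℤ) : Matrix ι ι ℤ)ᵀ * G * ((g * h : GL ι ℤ) : Matrix ι ι ℤ)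
          = (h : Matrix ι ι ℤ)ᵀ * ((g : Matrix ι ι ℤ)ᵀ * G * (g : Matrix ι ι ℤ)) * h := by
            simp [Matrix.transpose_mul, Matrix.mul_assoc]
        _ = G := by rw [hg, hh]
    · have e : act (g * h) v - v = act g (act h v - v) + (act g v - v) := by
        rw [act_mul, act_sub]; abel
      rw [e]
      exact add_mem (act_mem_integralVectors g (hh' v hv)) (hg' v hv)
  inv_mem' := by
    rintro g ⟨hg, hg'⟩
    refine ⟨?_, fun v hv => ?_⟩
    · have h1 : (g : Matrix ι ι ℤ) * ((g⁻¹ : GL ι ℤ) : Matrix ι ι ℤ) = 1 := by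
        rw [← Units.val_mul, mul_inv_cancel, Units.val_one]
      have h2 : ((g⁻¹ : GL ι ℤ) : Matrix ι ι ℤ)ᵀ * (g : Matrix ι ι ℤ)ᵀ = 1 := by
        rw [← Matrix.transpose_mul, h1, Matrix.transpose_one]
      calc ((g⁻¹ : GL ι ℤ) : Matrix ι ι ℤ)ᵀ * G * ((g⁻¹ : GL ι ℤ) : Matrix ι ι ℤ)
          = ((g⁻¹ : GL ι ℤ) : Matrix ι ι ℤ)ᵀ * ((g : Matrix ι ι ℤ)ᵀ * G * (g : Matrix ι ι ℤ))
              * ((g⁻¹ : GL ι ℤ) : Matrix ι ι ℤ) := by rw [hg]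
        _ = (((g⁻¹ : GL ι ℤ) : Matrix ι ι ℤ)ᵀ * (g : Matrix ι ι ℤ)ᵀ) * G *
              ((g : Matrix ι ι ℤ) * ((g⁻¹ : GL ι ℤ) : Matrix ι ι ℤ)) := by
            simp only [Matrix.mul_assoc]
        _ = G := by rw [h1, h2, Matrix.one_mul, Matrix.mul_one]
    · have e : act g⁻¹ v - v = -(act g⁻¹ (act g v - v)) := by
        rw [act_sub, ← act_mul, inv_mul_cancel, act_one]; abel
      rw [e]
      exact neg_mem (act_mem_integralVectors _ (hg' v hv))

/-! ### Period domains and period spaces -/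

/-- The cone `{z ∈ M ⊗ ℂ | ⟨z, z⟩ = 0, ⟨z, z̄⟩ < 0}` over the period domain. -/
def periodCone (G : Matrix ι ι ℤ) : Set (ι → ℂ) :=
  {z | pairing G z z = 0 ∧ (pairing G z (star z)).re < 0}

/-- The period domain `Ω(M) = {w ∈ ℙ(M ⊗ ℂ) | ⟨w, w⟩ = 0, ⟨w, w̄⟩ < 0}`. -/
def periodDomain (G : Matrix ι ι ℤ) : Set (ℙ ℂ (ι → ℂ)) :=
  {w | w.rep ∈ periodCone G}

theorem smul_mem_periodCone (G : Matrix ι ι ℤ) {a : ℂ} (ha : a ≠ 0) {z : ι → ℂ}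
    (hz : z ∈ periodCone G) : a • z ∈ periodCone G := by
  obtain ⟨h1, h2⟩ := hz
  refine ⟨?_, ?_⟩
  · simp only [pairing] at h1
    simp [pairing, Matrix.mulVec_smul, h1]
  · have e : pairing G (a • z) (star (a • z)) = (Complex.normSq a : ℂ) * pairing G z (star z) := by
      simp only [pairing, star_smul, Matrix.mulVec_smul, smul_dotProduct, dotProduct_smul,
        smul_eq_mul]
      rw [← mul_assoc, ← Complex.mul_conj, mul_comm a]
      rfl
    rw [e, Complex.re_ofReal_mul]
    exact mul_neg_of_pos_of_neg (Complex.normSq_pos.2 ha) h2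

/-- The condition defining the period domain does not depend on the representative. -/
theorem mk_mem_periodDomain (G : Matrix ι ι ℤ) {z : ι → ℂ} (hz : z ≠ 0) :
    Projectivization.mk ℂ z hz ∈ periodDomain G ↔ z ∈ periodCone G := by
  obtain ⟨a, ha⟩ := Projectivization.exists_smul_eq_mk_rep ℂ z hz
  change (Projectivization.mk ℂ z hz).rep ∈ periodCone G ↔ _
  rw [← ha]
  refine ⟨fun h => ?_, fun h => smul_mem_periodCone G a.ne_zero h⟩
  have := smul_mem_periodCone G (a⁻¹).ne_zero h
  rwa [show ((a⁻¹ : ℂˣ) : ℂ) • a • z = a⁻¹ • a • z from rfl, inv_smul_smul] at this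

/-- The natural action of `GL(M)` on `ℙ(M ⊗ ℂ)`, induced by `act`. -/
instance projAction : MulAction (GL ι ℤ) (ℙ ℂ (ι → ℂ)) :=
  MulAction.compHom (ℙ ℂ (ι → ℂ))
    ((Matrix.GeneralLinearGroup.toLin (n := ι) (R := ℂ)).toMonoidHom.comp
      (Matrix.GeneralLinearGroup.map (Int.castRingHom ℂ)))

theorem act_ne_zero (g : GL ι ℤ) {z : ι → ℂ} (hz : z ≠ 0) : act g z ≠ 0 := by
  intro h
  apply hz
  have := congrArg (act g⁻¹) h
  rwa [← act_mul, inv_mul_cancel, act_one, show act g⁻¹ (0 : ι → ℂ) = 0 from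
    Matrix.mulVec_zero _] at this

theorem smul_mk_eq (g : GL ι ℤ) {z : ι → ℂ} (hz : z ≠ 0) :
    g • Projectivization.mk ℂ z hz = Projectivization.mk ℂ (act g z) (act_ne_zero g hz) := rfl

theorem pairing_act {R : Type} [CommRing R] (G : Matrix ι ι ℤ) {g : GL ι ℤ}
    (hg : g ∈ monodromyGroup G) (x y : ι → R) :
    pairing G (act g x) (act g y) = pairing G x y := by
  have h := congrArg (fun A : Matrix ι ι ℤ => A.map (Int.castRingHom R)) hg.1
  simp only [Matrix.map_mul] at h
  have h' : ((g : Matrix ι ι ℤ).map (Int.cast : ℤ → R))ᵀ * G.map Int.cast *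
      (g : Matrix ι ι ℤ).map Int.cast = G.map (Int.cast : ℤ → R) := h
  simp only [pairing, act]
  conv_rhs => rw [← h']
  rw [Matrix.dotProduct_mulVec, Matrix.vecMul_mulVec, ← Matrix.dotProduct_mulVec,
    Matrix.mulVec_mulVec]

theorem act_mem_periodCone (G : Matrix ι ι ℤ) {g : GL ι ℤ} (hg : g ∈ monodromyGroup G)
    {z : ι → ℂ} (hz : z ∈ periodCone G) : act g z ∈ periodCone G := by
  have hs : star (act g z) = act g (star z) := by
    ext i
    simp [act, Matrix.mulVec, dotProduct]
  refine ⟨?_, ?_⟩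
  · rw [pairing_act G hg]; exact hz.1
  · rw [hs, pairing_act G hg]; exact hz.2

theorem smul_mem_periodDomain (G : Matrix ι ι ℤ) {g : GL ι ℤ} (hg : g ∈ monodromyGroup G)
    {w : ℙ ℂ (ι → ℂ)} (hw : w ∈ periodDomain G) : g • w ∈ periodDomain G := by
  induction w using Projectivization.ind with
  | h z hz =>
    rw [smul_mk_eq, mk_mem_periodDomain]
    exact act_mem_periodCone G hg ((mk_mem_periodDomain G hz).1 hw)

/-- The action of the monodromy group `Γ_M` on the period domain `Ω(M)`. -/
instance periodAction (G : Matrix ι ι ℤ) :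
    MulAction (monodromyGroup G) (periodDomain G) where
  smul g w := ⟨(g : GL ι ℤ) • (w : ℙ ℂ (ι → ℂ)), smul_mem_periodDomain G g.2 w.2⟩
  one_smul w := Subtype.ext (one_smul (GL ι ℤ) (w : ℙ ℂ (ι → ℂ)))
  mul_smul g h w := Subtype.ext (mul_smul (g : GL ι ℤ) (h : GL ι ℤ) (w : ℙ ℂ (ι → ℂ)))

/-- The period space `𝒫_M = Ω(M) / Γ_M`. -/
abbrev PeriodSpace (G : Matrix ι ι ℤ) : Type :=
  MulAction.orbitRel.Quotient (monodromyGroup G) (periodDomain G)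

/-- The quotient map `Ω(M) → 𝒫_M`. -/
def periodProj (G : Matrix ι ι ℤ) (w : periodDomain G) : PeriodSpace G :=
  Quotient.mk _ w

/-! ### Heegner divisors -/

/-- The hyperplane section `v^⊥ = {w ∈ Ω(M) | ⟨v, w⟩ = 0}` for `v ∈ M ⊗ ℚ`. -/
def hyperplaneSection (G : Matrix ι ι ℤ) (v : ι → ℚ) : Set (periodDomain G) :=
  {w | pairing G (fun i => (v i : ℂ)) (w : ℙ ℂ (ι → ℂ)).rep = 0}

/-- The (support of the) Heegner divisor `Y_{n,γ} ⊆ 𝒫_M`: the image of the union of all `v^⊥`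
with `v ∈ M^∨`, `v ≡ γ mod M` and `⟨v, v⟩ / 2 = n`. -/
def heegnerDivisor (G : Matrix ι ι ℤ) (n : ℚ) (γ : DiscriminantGroup G) :
    Set (PeriodSpace G) :=
  periodProj G '' ⋃ v ∈ {v : dualLattice G | discriminantClass G v = γ ∧
    1 / 2 * pairing G (v : ι → ℚ) v = n}, hyperplaneSection G v

/-! ### Closed analytic subsets and irreducible components -/

/-- Closed analytic subsets of the complex manifold `Ω(M)`. Here `Ω(M)` is the quotient by `ℂˣ` of
the locally closed complex submanifold `periodCone G` of `ι → ℂ`; `A` is closed analytic iff,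
near every point of the cone, its preimage in the cone is cut out by finitely many functions
that are holomorphic on an open subset of `ι → ℂ`. -/
def IsAnalyticInDomain (G : Matrix ι ι ℤ) (A : Set (periodDomain G)) : Prop :=
  ∀ z₀ ∈ periodCone G, ∃ U : Set (ι → ℂ), IsOpen U ∧ z₀ ∈ U ∧
    ∃ (k : ℕ) (f : Fin k → (ι → ℂ) → ℂ), (∀ i, DifferentiableOn ℂ (f i) U) ∧
      ∀ (w : periodDomain G) (z : ι → ℂ) (hz : z ≠ 0), z ∈ U →
        Projectivization.mk ℂ z hz = (w : ℙ ℂ (ι → ℂ)) → (w ∈ A ↔ ∀ i, f i z = 0)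

/-- Closed analytic subsets of the quotient `𝒫_M = Ω(M) / Γ_M`: those whose preimage in `Ω(M)` is
closed analytic. -/
def IsAnalytic (G : Matrix ι ι ℤ) (Z : Set (PeriodSpace G)) : Prop :=
  IsAnalyticInDomain G (periodProj G ⁻¹' Z)

/-- Irreducible closed analytic subsets: non-empty, and not the union of two proper closed
analytic subsets. -/
def IsIrreducibleAnalytic (G : Matrix ι ι ℤ) (Z : Set (PeriodSpace G)) : Prop :=
  IsAnalytic G Z ∧ Z.Nonempty ∧
    ∀ A B : Set (PeriodSpace G), IsAnalytic G A → IsAnalytic G B → Z = A ∪ B → Z = A ∨ Z = B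

/-- `Z` is an irreducible component of `Y`: a maximal irreducible closed analytic subset of
`𝒫_M` contained in `Y`. -/
def IsComponent (G : Matrix ι ι ℤ) (Z Y : Set (PeriodSpace G)) : Prop :=
  Maximal (fun T => IsIrreducibleAnalytic G T ∧ T ⊆ Y) Z

end Lattice

/-! ### The lattices of Gushel--Mukai fourfolds -/

/-- Index set of the standard basis of `A₁ ⊕ A₁ ⊕ E₈ ⊕ E₈ ⊕ U ⊕ U`. -/
abbrev VIdx : Type := Fin 2 ⊕ ((Fin 8 ⊕ Fin 8) ⊕ (Fin 2 ⊕ Fin 2))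

/-- The Gram matrix of the hyperbolic plane `U`. -/
def hyperbolicPlane : Matrix (Fin 2) (Fin 2) ℤ := !![0, 1; 1, 0]

/-- The Gram matrix of the vanishing lattice `Λ_GM = A₁^{⊕2} ⊕ E₈^{⊕2} ⊕ U^{⊕2}`. -/
def vanishingLattice : Matrix VIdx VIdx ℤ :=
  Matrix.fromBlocks !![2, 0; 0, 2] 0 0
    (Matrix.fromBlocks
      (Matrix.fromBlocks CartanMatrix.E₈ 0 0 CartanMatrix.E₈) 0 0
      (Matrix.fromBlocks hyperbolicPlane 0 0 hyperbolicPlane))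

/-- Index set of the standard basis of `⟨1⟩^{⊕22} ⊕ ⟨-1⟩^{⊕2}`. -/
abbrev HIdx : Type := Fin 22 ⊕ Fin 2

/-- The Gram matrix of `⟨1⟩^{⊕22} ⊕ ⟨-1⟩^{⊕2}`, the middle cohomology lattice `H⁴(X, ℤ)` of a
Gushel--Mukai fourfold `X`. -/
def middleLattice : Matrix HIdx HIdx ℤ :=
  Matrix.diagonal (Sum.elim (fun _ => 1) (fun _ => -1))

/-- The dual basis vector `b / 2` of the `i`-th standard generator `b` of `A₁^{⊕2} ⊆ Λ_GM`. -/
def halfGenerator (i : Fin 2) : VIdx → ℚ := Pi.single (Sum.inl i) (1 / 2)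

theorem halfGenerator_mem (i : Fin 2) : halfGenerator i ∈ dualLattice vanishingLattice := by
  intro m
  refine ⟨m (Sum.inl i), ?_⟩
  fin_cases i <;>
    simp [pairing, halfGenerator, vanishingLattice, Matrix.mulVec, dotProduct, Fin.sum_univ_two]

/-- `e_* = e / 2 ∈ Λ_GM^∨`, where `e` is the first standard generator of `A₁^{⊕2}`. -/
def eStar : dualLattice vanishingLattice := ⟨halfGenerator 0, halfGenerator_mem 0⟩

/-- `f_* = f / 2 ∈ Λ_GM^∨`, where `f` is the second standard generator of `A₁^{⊕2}`. -/
def fStar : dualLattice vanishingLattice := ⟨halfGenerator 1, halfGenerator_mem 1⟩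

/-- The matrix of intersection products of vectors of `H⁴(X, ℤ)`. -/
def gram {n : ℕ} (x : Fin n → HIdx → ℤ) : Matrix (Fin n) (Fin n) ℚ :=
  Matrix.of fun i j => ((pairing middleLattice (x i) (x j) : ℤ) : ℚ)

/-- `h₁, h₂` are orthogonal of square `2`, so that they span `Λ_Gr ≅ A₁^{⊕2}` in `H⁴(X, ℤ)`, and
`j` is an isometry from `Λ_GM` onto the orthogonal complement of `Λ_Gr`. -/
def IsMarking (h₁ h₂ : HIdx → ℤ) (j : (VIdx → ℤ) →ₗ[ℤ] (HIdx → ℤ)) : Prop :=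
  gram ![h₁, h₂] = !![2, 0; 0, 2] ∧
  (∀ x y, pairing middleLattice (j x) (j y) = pairing vanishingLattice x y) ∧
  ∀ y : HIdx → ℤ, (∃ x, j x = y) ↔
    (pairing middleLattice h₁ y = 0 ∧ pairing middleLattice h₂ y = 0)

/-- A labelling: a primitive rank-three sublattice of `H⁴(X, ℤ)` containing `Λ_Gr`. -/
def IsLabelling (h₁ h₂ : HIdx → ℤ) (K : Submodule ℤ (HIdx → ℤ)) : Prop :=
  Module.finrank ℤ K = 3 ∧ h₁ ∈ K ∧ h₂ ∈ K ∧
    ∀ (n : ℤ) (x : HIdx → ℤ), n ≠ 0 → n • x ∈ K → x ∈ K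

/-- `K` is a labelling `⟨h₁, h₂, ζ⟩` whose matrix of intersection products is `Q`. -/
def IsLabellingWithGram (h₁ h₂ : HIdx → ℤ) (Q : Matrix (Fin 3) (Fin 3) ℚ)
    (K : Submodule ℤ (HIdx → ℤ)) : Prop :=
  IsLabelling h₁ h₂ K ∧ ∃ ζ, K = Submodule.span ℤ {h₁, h₂, ζ} ∧ gram ![h₁, h₂, ζ] = Q

/-- The complex-linear extension `Λ_GM ⊗ ℂ → H⁴(X, ℂ)` of `j`. -/
def complexify (j : (VIdx → ℤ) →ₗ[ℤ] (HIdx → ℤ)) (z : VIdx → ℂ) : HIdx → ℂ :=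
  (LinearMap.toMatrix' j).map (Int.cast : ℤ → ℂ) *ᵥ z

/-- `{w ∈ Ω(Λ_GM) | w ⊥ K}`, where `Λ_GM` is embedded in `H⁴(X, ℤ)` by `j`. -/
def orthogonalSection (j : (VIdx → ℤ) →ₗ[ℤ] (HIdx → ℤ)) (K : Submodule ℤ (HIdx → ℤ)) :
    Set (periodDomain vanishingLattice) :=
  {w | ∀ k ∈ K, pairing middleLattice (complexify j (w : ℙ ℂ (VIdx → ℂ)).rep)
    (fun i => (k i : ℂ)) = 0}

/-- The period divisor in `𝒟 = 𝒫_{Λ_GM}` attached to the labelling `K`: the image of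
`{w ∈ Ω(Λ_GM) | w ⊥ K}`. -/
def periodDivisor (j : (VIdx → ℤ) →ₗ[ℤ] (HIdx → ℤ)) (K : Submodule ℤ (HIdx → ℤ)) :
    Set (PeriodSpace vanishingLattice) :=
  periodProj vanishingLattice '' orthogonalSection j K

/-- The period divisor attached to `K` is contained in the Heegner divisor `Y_{n,γ}` of `Λ_GM`, and
is one of its irreducible components. -/
def IsHeegnerComponent (j : (VIdx → ℤ) →ₗ[ℤ] (HIdx → ℤ)) (K : Submodule ℤ (HIdx → ℤ)) (n : ℚ)
    (γ : DiscriminantGroup vanishingLattice) : Prop :=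
  periodDivisor j K ⊆ heegnerDivisor vanishingLattice n γ ∧
    IsComponent vanishingLattice (periodDivisor j K) (heegnerDivisor vanishingLattice n γ)

end GushelMukai

end

/-! Put a = ⟨h₁, ζ⟩ and b = ⟨h₂, ζ⟩. The vector x = 2ζ - a h₁ - b h₂ is orthogonal to h₁ and h₂, so
it lies in Λ_GM, and v = x/2 is the orthogonal projection of ζ. On Λ_GM, pairing with v is pairing
with ζ. Hence v is in the dual lattice, a period is orthogonal to K exactly when it is orthogonal to
v, and ⟨v, v⟩ = ⟨ζ, ζ⟩ - (a² + b²)/2 = d/4. The period divisor is therefore the image of v^⊥.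

The class of v is a parity computation. Since E₈ and U are unimodular, the coordinates of x outside
A₁² are even, and d = ⟨x, x⟩ ≡ 2x₀² + 2x₁² mod 8. So d mod 8 counts the odd entries among x₀, x₁,
which settles d ≡ 0 and d ≡ 4. For d ≡ 2 the class depends only on (a, b), and (1, 0) and (0, 1)
give different classes; `IsMarking.exists_swap` turns this into one renaming valid for every d.

That the image Z of v^⊥ is a component (`IsTubeFrame.isComponent`) rests on three facts.
Analyticity: a definite majorant shows that near a period only finitely many dual vectors of given
norm have a hyperplane meeting the neighbourhood (`HasIndexTwo.finite_dual_vectors`).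
Irreducibility: Euclid's algorithm in U ⊕ U gives an integral hyperbolic pair e, f orthogonal to v
(`exists_isTubeFrame`). Normalising ⟨z, e⟩ = 1 presents v^⊥ as two opposite tube domains. Each is
convex, so the identity theorem forbids covering it by two analytic sets neither of which contains
it. The isometry that is -1 on e, f and 1 on their complement lies in Γ and exchanges the two
halves. Maximality: the hyperplanes of the Heegner divisor Y outside the orbits of ±v also have
analytic image. An irreducible T with Z ⊆ T ⊆ Y lies in Z or in that image. The second case is
excluded by Baire: if countably many hyperplanes cover v^⊥, one of them contains an open piece of
it, and its vector, having the norm of v, is then ±v. -/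

noncomputable section

namespace GushelMukai

/-! ### Real and imaginary parts, and bilinear algebra of the pairing. -/

section Parts

variable {ι : Type}

/-- The real part of a complex vector. -/
def rePart (z : ι → ℂ) : ι → ℝ := fun i => (z i).re

/-- The imaginary part of a complex vector. -/
def imPart (z : ι → ℂ) : ι → ℝ := fun i => (z i).im

theorem eq_rePart_add_imPart (z : ι → ℂ) :
    z = (fun i => (rePart z i : ℂ)) + Complex.I • (fun i => (imPart z i : ℂ)) := by
  ext i
  simp [rePart, imPart, mul_comm Complex.I, Complex.re_add_im]

theorem star_eq_rePart_sub_imPart (z : ι → ℂ) :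
    star z = (fun i => (rePart z i : ℂ)) - Complex.I • (fun i => (imPart z i : ℂ)) := by
  ext i
  apply Complex.ext <;> simp [rePart, imPart]

theorem continuous_rePart : Continuous (rePart : (ι → ℂ) → ι → ℝ) := by
  unfold rePart; fun_prop

theorem continuous_imPart : Continuous (imPart : (ι → ℂ) → ι → ℝ) := by
  unfold imPart; fun_prop

end Parts

section Pairing

variable {ι : Type} [Fintype ι] {R : Type} [CommRing R] (G : Matrix ι ι ℤ)

theorem pairing_eq_sum (x y : ι → R) :
    pairing G x y = ∑ i, ∑ k, x i * ((G i k : R) * y k) := by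
  simp [pairing, dotProduct, Matrix.mulVec, Finset.mul_sum]

theorem pairing_add_left (x y z : ι → R) :
    pairing G (x + y) z = pairing G x z + pairing G y z := add_dotProduct _ _ _

theorem pairing_add_right (x y z : ι → R) :
    pairing G x (y + z) = pairing G x y + pairing G x z := by
  simp [pairing, Matrix.mulVec_add, dotProduct_add]

theorem pairing_sub_left (x y z : ι → R) :
    pairing G (x - y) z = pairing G x z - pairing G y z := sub_dotProduct _ _ _

theorem pairing_sub_right (x y z : ι → R) :
    pairing G x (y - z) = pairing G x y - pairing G x z := by
  simp [pairing, Matrix.mulVec_sub, dotProduct_sub]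

theorem pairing_neg_left (x z : ι → R) : pairing G (-x) z = -pairing G x z :=
  neg_dotProduct _ _

theorem pairing_neg_right (x z : ι → R) : pairing G x (-z) = -pairing G x z := by
  simp [pairing, Matrix.mulVec_neg]

theorem pairing_smul_left (a : R) (x z : ι → R) :
    pairing G (a • x) z = a * pairing G x z := smul_dotProduct _ _ _

theorem pairing_smul_right (a : R) (x z : ι → R) :
    pairing G x (a • z) = a * pairing G x z := by
  simp [pairing, Matrix.mulVec_smul]

theorem pairing_zero_left (x : ι → R) : pairing G 0 x = 0 := zero_dotProduct _

theorem pairing_zero_right (x : ι → R) : pairing G x 0 = 0 := by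
  simp [pairing]

theorem pairing_comm (hG : G.IsSymm) (x y : ι → R) : pairing G x y = pairing G y x := by
  rw [pairing_eq_sum, pairing_eq_sum, Finset.sum_comm]
  refine Finset.sum_congr rfl fun i _ => Finset.sum_congr rfl fun k _ => ?_
  rw [hG.apply i k]
  ring

theorem pairing_map {S : Type} [CommRing S] (φ : R →+* S) (x y : ι → R) :
    pairing G (fun i => φ (x i)) (fun i => φ (y i)) = φ (pairing G x y) := by
  simp [pairing_eq_sum]

theorem pairing_intCast (x y : ι → ℤ) :
    pairing G (fun i => (x i : R)) (fun i => (y i : R)) = ((pairing G x y : ℤ) : R) :=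
  pairing_map G (Int.castRingHom R) x y

theorem pairing_ratCast_real (x y : ι → ℚ) :
    pairing G (fun i => (x i : ℝ)) (fun i => (y i : ℝ)) = ((pairing G x y : ℚ) : ℝ) :=
  pairing_map G (Rat.castHom ℝ) x y

theorem pairing_ofReal (x y : ι → ℝ) :
    pairing G (fun i => (x i : ℂ)) (fun i => (y i : ℂ)) = ((pairing G x y : ℝ) : ℂ) :=
  pairing_map G Complex.ofRealHom x y

theorem re_pairing_ofReal (x : ι → ℝ) (z : ι → ℂ) :
    (pairing G (fun i => (x i : ℂ)) z).re = pairing G x (rePart z) := by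
  simp [pairing_eq_sum, rePart]

theorem im_pairing_ofReal (x : ι → ℝ) (z : ι → ℂ) :
    (pairing G (fun i => (x i : ℂ)) z).im = pairing G x (imPart z) := by
  simp [pairing_eq_sum, imPart]

theorem pairing_ofReal_eq_zero_iff (x : ι → ℝ) (z : ι → ℂ) :
    pairing G (fun i => (x i : ℂ)) z = 0 ↔
      pairing G x (rePart z) = 0 ∧ pairing G x (imPart z) = 0 := by
  rw [Complex.ext_iff, re_pairing_ofReal, im_pairing_ofReal]
  rfl

theorem pairing_star_self (hG : G.IsSymm) (z : ι → ℂ) :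
    pairing G z (star z) =
      ((pairing G (rePart z) (rePart z) + pairing G (imPart z) (imPart z) : ℝ) : ℂ) := by
  conv_lhs => rw [star_eq_rePart_sub_imPart]
  conv_lhs => enter [2]; rw [eq_rePart_add_imPart z]
  simp only [pairing_add_left, pairing_sub_right, pairing_smul_left, pairing_smul_right,
    pairing_ofReal, pairing_comm G hG (imPart z) (rePart z)]
  push_cast
  linear_combination (-((pairing G (imPart z) (imPart z) : ℝ) : ℂ)) * Complex.I_mul_I

theorem pairing_self_eq (hG : G.IsSymm) (z : ι → ℂ) :
    pairing G z z =
      ((pairing G (rePart z) (rePart z) - pairing G (imPart z) (imPart z) : ℝ) : ℂ) +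
        ((2 * pairing G (rePart z) (imPart z) : ℝ) : ℂ) * Complex.I := by
  conv_lhs => rw [eq_rePart_add_imPart z]
  simp only [pairing_add_left, pairing_add_right, pairing_smul_left, pairing_smul_right,
    pairing_ofReal, pairing_comm G hG (imPart z) (rePart z)]
  push_cast
  linear_combination ((pairing G (imPart z) (imPart z) : ℝ) : ℂ) * Complex.I_mul_I

/-- A period is an orthogonal pair of real vectors of equal negative norm; every signature argument
is applied to the negative plane they span. -/
theorem mem_periodCone_iff (hG : G.IsSymm) (z : ι → ℂ) :
    z ∈ periodCone G ↔ pairing G (rePart z) (rePart z) = pairing G (imPart z) (imPart z) ∧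
      pairing G (rePart z) (imPart z) = 0 ∧ pairing G (rePart z) (rePart z) < 0 := by
  have h1 : pairing G z z = 0 ↔ pairing G (rePart z) (rePart z) = pairing G (imPart z) (imPart z) ∧
      pairing G (rePart z) (imPart z) = 0 := by
    rw [pairing_self_eq G hG, Complex.ext_iff]
    simp [sub_eq_zero]
  simp only [periodCone, Set.mem_ofPred_eq, h1, pairing_star_self G hG, Complex.ofReal_re]
  constructor
  · rintro ⟨⟨h, h'⟩, h2⟩
    exact ⟨h, h', by linarith⟩
  · rintro ⟨h, h', h2⟩
    exact ⟨⟨h, h'⟩, by linarith⟩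

theorem continuous_pairing {X : Type} [TopologicalSpace X] [TopologicalSpace R]
    [IsTopologicalRing R] {f g : X → ι → R} (hf : Continuous f) (hg : Continuous g) :
    Continuous fun t => pairing G (f t) (g t) := by
  simp only [pairing_eq_sum]
  fun_prop

theorem differentiable_pairing {E : Type} [NormedAddCommGroup E] [NormedSpace ℂ E]
    {f g : E → ι → ℂ} (hf : Differentiable ℂ f) (hg : Differentiable ℂ g) :
    Differentiable ℂ fun t => pairing G (f t) (g t) := by
  simp only [pairing_eq_sum]
  have hf' := differentiable_pi.1 hf
  have hg' := differentiable_pi.1 hg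
  fun_prop

end Pairing

/-! ### Signature (n, 2): majorants and uniform positivity. -/

section IndexTwo

variable {ι : Type} [Fintype ι] {G : Matrix ι ι ℤ}

/-- The form `G` is symmetric, and the orthogonal complement of every negative definite real plane
is positive definite: the signature of `G` is `(n, 2)` or has no negative definite planes. -/
structure HasIndexTwo (G : Matrix ι ι ℤ) : Prop where
  symm : G.IsSymm
  pos : ∀ x y w : ι → ℝ, pairing G x x < 0 → pairing G y y < 0 → pairing G x y = 0 →
    pairing G w x = 0 → pairing G w y = 0 → w ≠ 0 → 0 < pairing G w w

theorem HasIndexTwo.pos_of_periodCone (h : HasIndexTwo G) {z : ι → ℂ} (hz : z ∈ periodCone G)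
    {w : ι → ℝ} (hw : w ≠ 0) (hwz : pairing G (fun i => (w i : ℂ)) z = 0) :
    0 < pairing G w w := by
  obtain ⟨h1, h2, h3⟩ := (mem_periodCone_iff G h.symm z).1 hz
  obtain ⟨h4, h5⟩ := (pairing_ofReal_eq_zero_iff G w z).1 hwz
  exact h.pos _ _ w h3 (h1 ▸ h3) h2 h4 h5 hw

/-- Reversing the sign of the form on the negative plane of z makes it positive definite. The
expression is this majorant multiplied by -⟨Re z, Re z⟩, which keeps it polynomial in z and w. -/
theorem HasIndexTwo.majorant_pos (h : HasIndexTwo G) {z : ι → ℂ} (hz : z ∈ periodCone G)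
    {w : ι → ℝ} (hw : w ≠ 0) :
    0 < pairing G w w * -pairing G (rePart z) (rePart z) +
      2 * (pairing G w (rePart z) ^ 2 + pairing G w (imPart z) ^ 2) := by
  obtain ⟨h1, h2, h3⟩ := (mem_periodCone_iff G h.symm z).1 hz
  set x := rePart z
  set y := imPart z
  set s := pairing G x x with hs
  have hs0 : s ≠ 0 := h3.ne
  set a := pairing G w x with ha
  set b := pairing G w y with hb
  have hyx : pairing G y x = 0 := by rw [pairing_comm G h.symm, h2]
  -- The component of w orthogonal to the negative plane, on which the form is positive definite.
  set u := w - (a / s) • x - (b / s) • y with hu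
  have hux : pairing G u x = 0 := by
    simp only [hu, pairing_sub_left, pairing_smul_left, ← ha, ← hs, hyx]
    field_simp
    ring
  have huy : pairing G u y = 0 := by
    simp only [hu, pairing_sub_left, pairing_smul_left, ← hb, ← h1, h2]
    field_simp
    ring
  have hww : pairing G w w = pairing G u u + (a ^ 2 + b ^ 2) / s := by
    have hw' : w = u + (a / s) • x + (b / s) • y := by rw [hu]; abel
    rw [hw']
    simp only [pairing_add_left, pairing_add_right, pairing_smul_left, pairing_smul_right, hux, huy,
      pairing_comm G h.symm x u, pairing_comm G h.symm y u, hyx, h2, ← hs, ← h1]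
    field_simp
    ring
  have key : pairing G w w * -s + 2 * (a ^ 2 + b ^ 2) =
      pairing G u u * -s + (a ^ 2 + b ^ 2) := by
    rw [hww]
    field_simp
    ring
  rw [key]
  by_cases hu0 : u = 0
  · rw [hu0, pairing_zero_left, zero_mul, zero_add]
    by_contra hcon
    have ha0 : a = 0 := by nlinarith [sq_nonneg a, sq_nonneg b]
    have hb0 : b = 0 := by nlinarith [sq_nonneg a, sq_nonneg b]
    apply hw
    rw [hu, ha0, hb0] at hu0
    simpa using hu0
  · have := h.pos x y u h3 (h1 ▸ h3) h2 hux huy hu0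
    have := mul_pos this (neg_pos.2 h3)
    positivity

/-- The majorant is bounded below on the compact unit sphere, and the tube lemma spreads the bound
to nearby z. On vectors orthogonal to z the majorant is a multiple of the form itself. -/
theorem HasIndexTwo.exists_nhds_norm_le (h : HasIndexTwo G) {z₀ : ι → ℂ}
    (hz₀ : z₀ ∈ periodCone G) : ∃ U : Set (ι → ℂ), IsOpen U ∧ z₀ ∈ U ∧ ∃ δ > (0 : ℝ), ∀ z ∈ U,
      ∀ w : ι → ℝ, pairing G (fun i => (w i : ℂ)) z = 0 → δ * ‖w‖ ^ 2 ≤ pairing G w w := by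
  have hneg := ((mem_periodCone_iff G h.symm z₀).1 hz₀).2.2
  let F : (ι → ℝ) × (ι → ℂ) → ℝ := fun p =>
    pairing G p.1 p.1 * -pairing G (rePart p.2) (rePart p.2) +
      2 * (pairing G p.1 (rePart p.2) ^ 2 + pairing G p.1 (imPart p.2) ^ 2)
  let N : (ι → ℝ) × (ι → ℂ) → ℝ := fun p => -pairing G (rePart p.2) (rePart p.2)
  have hre : Continuous fun p : (ι → ℝ) × (ι → ℂ) => rePart p.2 :=
    continuous_rePart.comp continuous_snd
  have him : Continuous fun p : (ι → ℝ) × (ι → ℂ) => imPart p.2 :=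
    continuous_imPart.comp continuous_snd
  have hN : Continuous N := (continuous_pairing G hre hre).neg
  have hF : Continuous F :=
    ((continuous_pairing G continuous_fst continuous_fst).mul hN).add
      (continuous_const.mul (((continuous_pairing G continuous_fst hre).pow 2).add
        ((continuous_pairing G continuous_fst him).pow 2)))
  have hS : IsCompact (Metric.sphere (0 : ι → ℝ) 1) := isCompact_sphere _ _
  obtain ⟨m, hm, hmF⟩ := hS.exists_forall_le' (f := fun w => F (w, z₀)) (a := 0)
    (hF.comp (by fun_prop)).continuousOn fun w hw => h.majorant_pos hz₀ (by
      rintro rfl; simp at hw)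
  -- The factor 2 gives δ N = m/2 < m, so the inequality at z₀ is strict and defines an open set.
  set δ := m / (2 * N (0, z₀)) with hδ
  have hN0 : 0 < N (0, z₀) := neg_pos.2 hneg
  have hδ0 : 0 < δ := by positivity
  have hO : IsOpen {p : (ι → ℝ) × (ι → ℂ) | δ * N p < F p ∧ 0 < N p} :=
    (isOpen_lt (continuous_const.mul hN) hF).inter (isOpen_lt continuous_const hN)
  obtain ⟨V, U, -, hU, hV, hzU, hVU⟩ := generalized_tube_lemma hS isCompact_singleton hO (by
    rintro ⟨w, z⟩ ⟨hw, hz⟩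
    obtain rfl : z = z₀ := hz
    refine ⟨lt_of_lt_of_le ?_ (hmF w hw), hN0⟩
    have : δ * N (w, z) = m / 2 := by
      change δ * N (0, z) = _
      rw [hδ]; field_simp
    rw [this]
    linarith)
  refine ⟨U, hU, by simpa using hzU, δ, hδ0, fun z hz w hw => ?_⟩
  by_cases hw0 : w = 0
  · simp [hw0, pairing_zero_left]
  have hn : 0 < ‖w‖ := norm_pos_iff.2 hw0
  have hmem : (‖w‖⁻¹ • w, z) ∈ V ×ˢ U := ⟨hV (by simp [norm_smul, hn.ne']), hz⟩
  obtain ⟨h1, h2⟩ := hVU hmem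
  obtain ⟨h3, h4⟩ := (pairing_ofReal_eq_zero_iff G w z).1 hw
  simp only [F, pairing_smul_left, pairing_smul_right, h3, h4] at h1
  change 0 < -pairing G (rePart z) (rePart z) at h2
  change δ * -pairing G (rePart z) (rePart z) < _ at h1
  have h5 : δ < ‖w‖⁻¹ * (‖w‖⁻¹ * pairing G w w) := by
    refine lt_of_mul_lt_mul_right ?_ h2.le
    linarith
  have h6 : ‖w‖⁻¹ * (‖w‖⁻¹ * pairing G w w) * ‖w‖ ^ 2 = pairing G w w := by
    field_simp
  nlinarith [sq_nonneg ‖w‖]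

end IndexTwo

/-! ### Local finiteness and analyticity of hyperplane arrangements. -/

section Arrangements

variable {ι : Type} [Fintype ι] {G : Matrix ι ι ℤ}

/-- A vector of norm N orthogonal to a period near z₀ is bounded by the uniform estimate, and its
products with the lattice basis are integers; so only finitely many lists of products occur. -/
theorem HasIndexTwo.finite_dual_vectors (h : HasIndexTwo G) {z₀ : ι → ℂ}
    (hz₀ : z₀ ∈ periodCone G) (N : ℚ) : ∃ U : Set (ι → ℂ), IsOpen U ∧ z₀ ∈ U ∧
      {v : ι → ℚ | v ∈ dualLattice G ∧ pairing G v v = N ∧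
        ∃ z ∈ U, pairing G (fun i => (v i : ℂ)) z = 0}.Finite := by
  classical
  obtain ⟨U, hU, hzU, δ, hδ, hb⟩ := h.exists_nhds_norm_le hz₀
  refine ⟨U, hU, hzU, ?_⟩
  set C : ℝ := ∑ i, ∑ k, |(G i k : ℝ)| with hC
  have hC0 : 0 ≤ C := by positivity
  set B : ℝ := Real.sqrt (N / δ) * C with hB
  -- The products with the basis vectors; on the dual lattice the floor merely reads a rational
  -- integer as an element of ℤ.
  let f : (ι → ℚ) → ι → ℤ := fun v k => ⌊pairing G v (fun i => ((Pi.single k 1 : ι → ℤ) i : ℚ))⌋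
  have hf : ∀ v ∈ dualLattice G, ∀ k, ((f v k : ℤ) : ℚ) = ∑ i, v i * G i k := by
    intro v hv k
    obtain ⟨n, hn⟩ := hv (Pi.single k 1)
    have : f v k = n := by simp only [f, hn, Int.floor_intCast]
    rw [this, ← hn, pairing_eq_sum]
    simp [Pi.single_apply]
  refine Set.Finite.of_injOn (f := f) (t := Set.Icc (fun _ => -⌈B⌉) (fun _ => ⌈B⌉)) ?_ ?_
    (Set.finite_Icc _ _)
  · rintro v ⟨hv, hvN, z, hz, hvz⟩
    have hw := hb z hz (fun i => (v i : ℝ)) (by simpa using hvz)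
    rw [pairing_ratCast_real, hvN] at hw
    set w : ι → ℝ := fun i => (v i : ℝ) with hwdef
    have hnorm : ‖w‖ ≤ Real.sqrt (N / δ) := by
      apply Real.le_sqrt_of_sq_le
      rw [le_div_iff₀ hδ]
      linarith
    have habs : ∀ k, |((f v k : ℤ) : ℝ)| ≤ B := by
      intro k
      have e : ((f v k : ℤ) : ℝ) = ∑ i, w i * G i k := by
        have := congrArg (Rat.cast : ℚ → ℝ) (hf v hv k)
        push_cast at this
        exact this
      rw [e]
      calc |∑ i, w i * G i k| ≤ ∑ i, |w i * G i k| := Finset.abs_sum_le_sum_abs _ _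
        _ ≤ ∑ i, ‖w‖ * ∑ k, |(G i k : ℝ)| := by
            refine Finset.sum_le_sum fun i _ => ?_
            rw [abs_mul]
            refine mul_le_mul (norm_le_pi_norm w i) ?_ (abs_nonneg _) (norm_nonneg _)
            exact Finset.single_le_sum (f := fun k => |(G i k : ℝ)|)
              (fun _ _ => abs_nonneg _) (Finset.mem_univ k)
        _ = ‖w‖ * C := by rw [Finset.mul_sum]
        _ ≤ B := mul_le_mul_of_nonneg_right hnorm hC0
    constructor <;> intro k
    · have := (abs_le.1 (habs k)).1
      have h2 := Int.le_ceil B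
      have : ((-⌈B⌉ : ℤ) : ℝ) ≤ (f v k : ℝ) := by push_cast; linarith
      exact_mod_cast this
    · have := (abs_le.1 (habs k)).2
      have h2 := Int.le_ceil B
      have : (f v k : ℝ) ≤ (⌈B⌉ : ℝ) := by linarith
      exact_mod_cast this
  -- Injectivity is nondegeneracy: a nonzero difference in the radical would be orthogonal to z₀,
  -- hence of positive norm, yet orthogonal to itself.
  · rintro v ⟨hv, -⟩ v' ⟨hv', -⟩ hvv
    by_contra hne
    have h0 : ∀ k, ∑ i, (v i - v' i) * (G i k : ℚ) = 0 := by
      intro k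
      simp only [sub_mul, Finset.sum_sub_distrib, ← hf v hv k, ← hf v' hv' k, hvv, sub_self]
    have h1 : ∀ z : ι → ℂ, pairing G (fun i => (((v i - v' i : ℚ) : ℝ) : ℂ)) z = 0 := by
      intro z
      rw [pairing_eq_sum, Finset.sum_comm]
      refine Finset.sum_eq_zero fun k _ => ?_
      have := congrArg (Rat.cast : ℚ → ℂ) (h0 k)
      push_cast at this ⊢
      rw [← zero_mul (z k), ← this, Finset.sum_mul]
      exact Finset.sum_congr rfl fun i _ => by ring
    have h2 := h.pos_of_periodCone hz₀ (w := fun i => ((v i - v' i : ℚ) : ℝ)) (by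
      intro hcon
      apply hne
      ext i
      have := congrFun hcon i
      simp only [Pi.zero_apply, Rat.cast_eq_zero, sub_eq_zero] at this
      exact this) (h1 z₀)
    have h3 := h1 (fun i => (((v i - v' i : ℚ) : ℝ) : ℂ))
    rw [pairing_ofReal] at h3
    norm_cast at h3
    exact h2.ne' (by exact_mod_cast h3)

theorem ne_zero_of_mem_periodCone {z : ι → ℂ} (hz : z ∈ periodCone G) : z ≠ 0 := by
  rintro rfl
  have := hz.2
  simp [pairing_zero_left] at this

theorem rep_mem_periodCone (w : periodDomain G) :
    (w : ℙ ℂ (ι → ℂ)).rep ∈ periodCone G := w.2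

theorem mk_rep_eq (w : periodDomain G) :
    Projectivization.mk ℂ (w : ℙ ℂ (ι → ℂ)).rep (Projectivization.rep_nonzero _) =
      (w : ℙ ℂ (ι → ℂ)) := Projectivization.mk_rep _

theorem mem_hyperplaneSection_iff {v : ι → ℚ} {w : periodDomain G} {z : ι → ℂ} (hz : z ≠ 0)
    (hw : Projectivization.mk ℂ z hz = (w : ℙ ℂ (ι → ℂ))) :
    w ∈ hyperplaneSection G v ↔ pairing G (fun i => (v i : ℂ)) z = 0 := by
  obtain ⟨a, ha⟩ := Projectivization.exists_smul_eq_mk_rep ℂ z hz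
  change pairing G (fun i => (v i : ℂ)) (w : ℙ ℂ (ι → ℂ)).rep = 0 ↔ _
  rw [← hw, ← ha, show a • z = (a : ℂ) • z from rfl, pairing_smul_right]
  simp

/-- The union of the hyperplane sections `v^⊥` for `v ∈ S`. -/
def arrangement (G : Matrix ι ι ℤ) (S : Set (ι → ℚ)) : Set (periodDomain G) :=
  ⋃ v ∈ S, hyperplaneSection G v

theorem mem_arrangement_iff {S : Set (ι → ℚ)} {w : periodDomain G} {z : ι → ℂ} (hz : z ≠ 0)
    (hw : Projectivization.mk ℂ z hz = (w : ℙ ℂ (ι → ℂ))) :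
    w ∈ arrangement G S ↔ ∃ v ∈ S, pairing G (fun i => (v i : ℂ)) z = 0 := by
  simp only [arrangement, Set.mem_iUnion, mem_hyperplaneSection_iff hz hw, exists_prop]

/-- A set of vectors of the dual lattice of constant norm is locally finite on the period domain:
its hyperplane sections form a closed analytic subset. -/
theorem HasIndexTwo.isAnalyticInDomain_arrangement (h : HasIndexTwo G) {S : Set (ι → ℚ)} {N : ℚ}
    (hS : ∀ v ∈ S, v ∈ dualLattice G ∧ pairing G v v = N) :
    IsAnalyticInDomain G (arrangement G S) := by
  intro z₀ hz₀
  obtain ⟨U, hU, hzU, hfin⟩ := h.finite_dual_vectors hz₀ N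
  have hfin' : (S ∩ {v | ∃ z ∈ U, pairing G (fun i => (v i : ℂ)) z = 0}).Finite :=
    hfin.subset fun v hv => ⟨(hS v hv.1).1, (hS v hv.1).2, hv.2⟩
  -- One equation suffices: the product of the linear forms of the finitely many vectors that matter
  -- on U.
  refine ⟨U, hU, hzU, 1, fun _ z => ∏ v ∈ hfin'.toFinset, pairing G (fun i => (v i : ℂ)) z,
    fun _ => ?_, ?_⟩
  · refine Differentiable.differentiableOn ?_
    classical
    exact fun z => (HasFDerivAt.finsetProd (u := hfin'.toFinset)
      (g := fun (v : ι → ℚ) z => pairing G (fun i => (v i : ℂ)) z) fun v _ =>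
        (differentiable_pairing G (differentiable_const _)
          differentiable_id z).hasFDerivAt).differentiableAt
  · intro w z hz hzU hw
    rw [mem_arrangement_iff hz hw]
    simp only [forall_const, Finset.prod_eq_zero_iff, Set.Finite.mem_toFinset]
    constructor
    · rintro ⟨v, hv, hvz⟩
      exact ⟨v, ⟨hv, z, hzU, hvz⟩, hvz⟩
    · rintro ⟨v, ⟨hv, -⟩, hvz⟩
      exact ⟨v, hv, hvz⟩

theorem IsAnalyticInDomain.inter {A B : Set (periodDomain G)} (hA : IsAnalyticInDomain G A)
    (hB : IsAnalyticInDomain G B) : IsAnalyticInDomain G (A ∩ B) := by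
  intro z₀ hz₀
  obtain ⟨U, hU, hzU, k, f, hf, hfA⟩ := hA z₀ hz₀
  obtain ⟨V, hV, hzV, l, g, hg, hgB⟩ := hB z₀ hz₀
  refine ⟨U ∩ V, hU.inter hV, ⟨hzU, hzV⟩, k + l, Fin.append f g, ?_, ?_⟩
  · intro i
    refine Fin.addCases (fun i => ?_) (fun i => ?_) i
    · rw [Fin.append_left]; exact (hf i).mono Set.inter_subset_left
    · rw [Fin.append_right]; exact (hg i).mono Set.inter_subset_right
  · intro w z hz hzUV hw
    rw [Set.mem_inter_iff, hfA w z hz hzUV.1 hw, hgB w z hz hzUV.2 hw]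
    constructor
    · rintro ⟨h1, h2⟩ i
      refine Fin.addCases (fun i => ?_) (fun i => ?_) i
      · rw [Fin.append_left]; exact h1 i
      · rw [Fin.append_right]; exact h2 i
    · intro h
      refine ⟨fun i => ?_, fun i => ?_⟩
      · simpa using h (Fin.castAdd l i)
      · simpa using h (Fin.natAdd k i)

end Arrangements

/-! ### Descent to the quotient by the monodromy group. -/

section Quotient

variable {ι : Type} [Fintype ι] [DecidableEq ι] {G : Matrix ι ι ℤ}

theorem act_map {R S : Type} [CommRing R] [CommRing S] (φ : R →+* S) (g : GL ι ℤ) (x : ι → R) :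
    act g (fun i => φ (x i)) = fun i => φ (act g x i) := by
  ext i
  simp [act, Matrix.mulVec, dotProduct]

theorem act_ratCast (g : GL ι ℤ) (x : ι → ℚ) :
    act g (fun i => (x i : ℂ)) = fun i => ((act g x i : ℚ) : ℂ) :=
  act_map (Rat.castHom ℂ) g x

theorem act_mem_dualLattice {g : GL ι ℤ} (hg : g ∈ monodromyGroup G) {v : ι → ℚ}
    (hv : v ∈ dualLattice G) : act g v ∈ dualLattice G := by
  have := add_mem hv (show act g v - v ∈ dualLattice G from ?_)
  · simpa using this
  obtain ⟨m, hm⟩ := hg.2 v hv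
  rw [hm]
  intro n
  exact ⟨_, pairing_intCast G m n⟩

theorem periodProj_eq_iff (w w' : periodDomain G) :
    periodProj G w = periodProj G w' ↔ ∃ g : monodromyGroup G, g • w' = w := by
  rw [periodProj, periodProj, Quotient.eq]
  rfl

theorem smul_mem_hyperplaneSection (g : monodromyGroup G) {v : ι → ℚ} {w : periodDomain G}
    (hw : w ∈ hyperplaneSection G v) : g • w ∈ hyperplaneSection G (act (g : GL ι ℤ) v) := by
  have e : Projectivization.mk ℂ (act (g : GL ι ℤ) (w : ℙ ℂ (ι → ℂ)).rep)
      (act_ne_zero _ (Projectivization.rep_nonzero _)) = ((g • w : periodDomain G) : ℙ ℂ (ι → ℂ)) := by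
    rw [← smul_mk_eq _ (Projectivization.rep_nonzero _), mk_rep_eq]
    rfl
  rw [mem_hyperplaneSection_iff _ e, ← act_ratCast, pairing_act G g.2]
  exact hw

/-- A set of vectors stable under the monodromy group. -/
def IsStable (G : Matrix ι ι ℤ) (S : Set (ι → ℚ)) : Prop :=
  ∀ g ∈ monodromyGroup G, ∀ v ∈ S, act g v ∈ S

/-- Analyticity in the quotient is tested on the preimage in Ω; for a stable set of vectors this
preimage is again an arrangement. -/
theorem IsStable.preimage_image {S : Set (ι → ℚ)} (hS : IsStable G S) :
    periodProj G ⁻¹' (periodProj G '' arrangement G S) = arrangement G S := by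
  refine Set.Subset.antisymm ?_ (Set.subset_preimage_image _ _)
  rintro w ⟨w', hw', he⟩
  obtain ⟨g, rfl⟩ := (periodProj_eq_iff w w').1 he.symm
  simp only [arrangement, Set.mem_iUnion, exists_prop] at hw' ⊢
  obtain ⟨v, hv, hvw⟩ := hw'
  exact ⟨_, hS g g.2 v hv, smul_mem_hyperplaneSection g hvw⟩

/-- The orbit of `v` under the monodromy group. -/
def monodromyOrbit (G : Matrix ι ι ℤ) (v : ι → ℚ) : Set (ι → ℚ) :=
  {u | ∃ g ∈ monodromyGroup G, act g v = u}

theorem isStable_monodromyOrbit (v : ι → ℚ) : IsStable G (monodromyOrbit G v) := by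
  rintro g hg _ ⟨g', hg', rfl⟩
  exact ⟨g * g', mul_mem hg hg', act_mul _ _ _⟩

theorem self_mem_monodromyOrbit (v : ι → ℚ) : v ∈ monodromyOrbit G v :=
  ⟨1, one_mem _, act_one v⟩

/-- Replacing v by its orbit makes the set stable without changing the image. -/
theorem image_arrangement_monodromyOrbit (v : ι → ℚ) :
    periodProj G '' arrangement G (monodromyOrbit G v) =
      periodProj G '' hyperplaneSection G v := by
  refine Set.Subset.antisymm ?_ (Set.image_mono ?_)
  · rintro _ ⟨w, hw, rfl⟩
    simp only [arrangement, Set.mem_iUnion, exists_prop] at hw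
    obtain ⟨_, ⟨g, hg, rfl⟩, hw⟩ := hw
    refine ⟨(⟨g, hg⟩ : monodromyGroup G)⁻¹ • w, ?_, ?_⟩
    · have := smul_mem_hyperplaneSection (⟨g, hg⟩ : monodromyGroup G)⁻¹ hw
      rwa [← act_mul, show (((⟨g, hg⟩ : monodromyGroup G)⁻¹ : monodromyGroup G) : GL ι ℤ) = g⁻¹
        from rfl, inv_mul_cancel, act_one] at this
    · exact (periodProj_eq_iff _ _).2 ⟨_, rfl⟩
  · exact Set.subset_biUnion_of_mem (u := fun v => hyperplaneSection G v)
      (self_mem_monodromyOrbit v)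

theorem monodromyOrbit_norm {v u : ι → ℚ} (hv : v ∈ dualLattice G)
    (hu : u ∈ monodromyOrbit G v) : u ∈ dualLattice G ∧ pairing G u u = pairing G v v := by
  obtain ⟨g, hg, rfl⟩ := hu
  exact ⟨act_mem_dualLattice hg hv, pairing_act G hg v v⟩

theorem HasIndexTwo.isAnalytic_image_arrangement (h : HasIndexTwo G) {S : Set (ι → ℚ)} {N : ℚ}
    (hS : ∀ v ∈ S, v ∈ dualLattice G ∧ pairing G v v = N) (hst : IsStable G S) :
    IsAnalytic G (periodProj G '' arrangement G S) := by
  rw [IsAnalytic, hst.preimage_image]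
  exact h.isAnalyticInDomain_arrangement hS

theorem IsAnalytic.inter {A B : Set (PeriodSpace G)} (hA : IsAnalytic G A)
    (hB : IsAnalytic G B) : IsAnalytic G (A ∩ B) :=
  IsAnalyticInDomain.inter hA hB

end Quotient

/-! ### The identity theorem and irreducibility of convex domains. -/

section Convex

variable {E : Type} [NormedAddCommGroup E] [NormedSpace ℂ E]

/-- Restrict to the complex line through q and p: its intersection with W is convex, so the
one-variable identity theorem applies. -/
theorem eq_zero_of_eventuallyEq_zero_of_convex {f : E → ℂ} {W : Set E} (hW : IsOpen W)
    (hc : Convex ℝ W) (hf : DifferentiableOn ℂ f W) {q : E} (hq : q ∈ W)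
    (h0 : f =ᶠ[nhds q] 0) {p : E} (hp : p ∈ W) : f p = 0 := by
  let ℓ : ℂ → E := fun t => q + t • (p - q)
  have hℓ : Differentiable ℂ ℓ := by fun_prop
  have hpre : IsOpen (ℓ ⁻¹' W) := hW.preimage hℓ.continuous
  have hconv : Convex ℝ (ℓ ⁻¹' W) := by
    intro s hs t ht a b ha hb hab
    have : ℓ (a • s + b • t) = a • ℓ s + b • ℓ t := by
      have e : q = a • q + b • q := by rw [← add_smul, hab, one_smul]
      simp only [ℓ, add_smul, smul_add, smul_assoc]
      nth_rewrite 1 [e]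
      abel
    rw [Set.mem_preimage, this]
    exact hc hs ht ha hb hab
  have han : AnalyticOnNhd ℂ (f ∘ ℓ) (ℓ ⁻¹' W) :=
    (hf.comp hℓ.differentiableOn fun t ht => ht).analyticOnNhd hpre
  have h00 : (0 : ℂ) ∈ ℓ ⁻¹' W := by simpa [ℓ] using hq
  have hev : f ∘ ℓ =ᶠ[nhds 0] 0 := by
    have : Filter.Tendsto ℓ (nhds 0) (nhds q) := by
      have := hℓ.continuous.tendsto 0
      simpa [ℓ] using this
    exact this.eventually h0
  have := han.eqOn_zero_of_preconnected_of_eventuallyEq_zero hconv.isPreconnected h00 hev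
    (show (1 : ℂ) ∈ ℓ ⁻¹' W by simpa [ℓ] using hp)
  simpa [ℓ] using this

/-- `A` is locally in `H` the set of common zeros of finitely many holomorphic functions. -/
def IsLocallyAnalyticOn (H A : Set E) : Prop :=
  ∀ p ∈ H, ∃ W : Set E, IsOpen W ∧ p ∈ W ∧ ∃ (k : ℕ) (f : Fin k → E → ℂ),
    (∀ i, DifferentiableOn ℂ (f i) W) ∧ ∀ q ∈ W ∩ H, q ∈ A ↔ ∀ i, f i q = 0

theorem IsLocallyAnalyticOn.mem_of_mem_closure {H A : Set E} (hA : IsLocallyAnalyticOn H A)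
    {p : E} (hp : p ∈ H) (hpA : p ∈ closure (A ∩ H)) : p ∈ A := by
  obtain ⟨W, hW, hpW, k, f, hf, hfA⟩ := hA p hp
  refine (hfA p ⟨hpW, hp⟩).2 fun i => ?_
  have hcont : ContinuousAt (f i) p := ((hf i).continuousOn.continuousAt (hW.mem_nhds hpW))
  by_contra hne
  have hev : ∀ᶠ q in nhds p, q ∈ W ∧ f i q ≠ 0 :=
    Filter.Eventually.and (hW.mem_nhds hpW) (hcont.eventually_ne hne)
  obtain ⟨q, ⟨hqW, hq⟩, hqA, hqH⟩ := mem_closure_iff_nhds.1 hpA _ hev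
  exact hq ((hfA q ⟨hqW, hqH⟩).1 hqA i)

/-- By the identity theorem on small balls the interior of A is relatively closed in H, and H is
connected. -/
theorem IsLocallyAnalyticOn.subset_of_interior_nonempty {H A : Set E} (hH : IsOpen H)
    (hc : Convex ℝ H) (hA : IsLocallyAnalyticOn H A) (hne : (interior A ∩ H).Nonempty) :
    H ⊆ A := by
  have hsub : H ⊆ interior A := by
    refine hc.isPreconnected.subset_of_closure_inter_subset isOpen_interior
      (by rwa [Set.inter_comm]) ?_
    rintro p ⟨hpc, hpH⟩
    obtain ⟨W, hW, hpW, k, f, hf, hfA⟩ := hA p hpH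
    obtain ⟨r, hr, hball⟩ := Metric.isOpen_iff.1 (hW.inter hH) p ⟨hpW, hpH⟩
    obtain ⟨q, hq, hqA⟩ := mem_closure_iff_nhds.1 hpc _ (Metric.ball_mem_nhds p hr)
    have hbA : Metric.ball p r ⊆ A := by
      intro s hs
      refine (hfA s (hball hs)).2 fun i => ?_
      refine eq_zero_of_eventuallyEq_zero_of_convex Metric.isOpen_ball
        ((convex_ball p r)) ((hf i).mono (hball.trans Set.inter_subset_left)) hq ?_ hs
      filter_upwards [isOpen_interior.mem_nhds hqA, Metric.isOpen_ball.mem_nhds hq] with t ht ht'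
      exact (hfA t (hball ht')).1 (interior_subset ht) i
    exact interior_maximal hbA Metric.isOpen_ball (Metric.mem_ball_self hr)
  exact hsub.trans interior_subset

/-- If A has no interior in H, then B is dense in H; being relatively closed, B contains H. -/
theorem IsLocallyAnalyticOn.subset_or_subset {H A B : Set E} (hH : IsOpen H)
    (hc : Convex ℝ H) (hA : IsLocallyAnalyticOn H A) (hB : IsLocallyAnalyticOn H B)
    (hAB : H ⊆ A ∪ B) : H ⊆ A ∨ H ⊆ B := by
  by_cases hne : (interior A ∩ H).Nonempty
  · exact Or.inl (hA.subset_of_interior_nonempty hH hc hne)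
  · refine Or.inr fun p hp => hB.mem_of_mem_closure hp ?_
    rw [mem_closure_iff_nhds]
    intro V hV
    by_contra hcon
    apply hne
    refine ⟨p, ?_, hp⟩
    rw [mem_interior_iff_mem_nhds]
    filter_upwards [hV, hH.mem_nhds hp] with q hqV hqH
    rcases hAB hqH with h | h
    · exact h
    · exact absurd ⟨q, hqV, h, hqH⟩ hcon

end Convex

/-! ### Parametrising the quadric cone in v^⊥ by a hyperbolic pair. -/

section Projection

variable {ι : Type} [Fintype ι] {R : Type} [Field R] {G : Matrix ι ι ℤ}

/-- The orthogonal projection to the complement of the hyperbolic pair `e, f` and of `v`. -/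
def frameProj (G : Matrix ι ι ℤ) (v e f u : ι → R) : ι → R :=
  u - pairing G u f • e - pairing G u e • f - (pairing G u v / pairing G v v) • v

/-- The point of the quadric cone in `v^⊥` with `e`-coordinate `1` attached to `u`. -/
def tubeMap (G : Matrix ι ι ℤ) (v e f u : ι → R) : ι → R :=
  f + frameProj G v e f u -
    (pairing G (frameProj G v e f u) (frameProj G v e f u) / 2) • e

/-- `e, f` is a hyperbolic pair orthogonal to the anisotropic vector `v`. -/
structure IsFrame (G : Matrix ι ι ℤ) (v e f : ι → R) : Prop where
  vv : pairing G v v ≠ 0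
  ee : pairing G e e = 0
  ff : pairing G f f = 0
  ef : pairing G e f = 1
  ve : pairing G v e = 0
  vf : pairing G v f = 0

variable {v e f : ι → R}

theorem frameProj_add (u w : ι → R) :
    frameProj G v e f (u + w) = frameProj G v e f u + frameProj G v e f w := by
  ext i
  simp only [frameProj, pairing_add_left, Pi.sub_apply, Pi.add_apply, Pi.smul_apply, smul_eq_mul]
  ring

theorem frameProj_smul (a : R) (u : ι → R) :
    frameProj G v e f (a • u) = a • frameProj G v e f u := by
  ext i
  simp only [frameProj, pairing_smul_left, Pi.sub_apply, Pi.smul_apply, smul_eq_mul]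
  ring

theorem frameProj_neg (u : ι → R) : frameProj G v e f (-u) = -frameProj G v e f u := by
  rw [← neg_one_smul R u, frameProj_smul, neg_one_smul]

theorem frameProj_of_orthogonal {u : ι → R} (he : pairing G u e = 0) (hf : pairing G u f = 0)
    (hv : pairing G u v = 0) : frameProj G v e f u = u := by
  simp [frameProj, he, hf, hv]

theorem IsFrame.pairing_frameProj_f (h : IsFrame G v e f) (u : ι → R) : pairing G (frameProj G v e f u) f = 0 := by
  simp only [frameProj, pairing_sub_left, pairing_smul_left, h.ff, h.vf, h.ef]
  ring

theorem IsFrame.pairing_tubeMap_f (h : IsFrame G v e f) (u : ι → R) : pairing G (tubeMap G v e f u) f =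
    -(pairing G (frameProj G v e f u) (frameProj G v e f u) / 2) := by
  simp [tubeMap, pairing_sub_left, pairing_add_left, pairing_smul_left,
    h.pairing_frameProj_f, h.ff, h.ef]

section

variable (hG : G.IsSymm) (h : IsFrame G v e f)
include hG h

theorem IsFrame.pairing_frameProj_e (u : ι → R) : pairing G (frameProj G v e f u) e = 0 := by
  simp only [frameProj, pairing_sub_left, pairing_smul_left, h.ee, h.ve,
    pairing_comm G hG f e, h.ef]
  ring

theorem IsFrame.pairing_frameProj_v (u : ι → R) : pairing G (frameProj G v e f u) v = 0 := by
  have := h.vv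
  simp only [frameProj, pairing_sub_left, pairing_smul_left, pairing_comm G hG e v,
    pairing_comm G hG f v, h.ve, h.vf]
  field_simp
  ring

/-- The projection is idempotent and self-adjoint. -/
theorem IsFrame.pairing_frameProj (u w : ι → R) :
    pairing G (frameProj G v e f u) (frameProj G v e f w) =
      pairing G (frameProj G v e f u) w := by
  conv_lhs => rw [frameProj.eq_1 G v e f w]
  simp only [pairing_sub_right, pairing_smul_right, h.pairing_frameProj_e hG,
    h.pairing_frameProj_f, h.pairing_frameProj_v hG]
  ring

theorem IsFrame.pairing_tubeMap_v (u : ι → R) : pairing G (tubeMap G v e f u) v = 0 := by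
  simp [tubeMap, pairing_sub_left, pairing_add_left, pairing_smul_left,
    h.pairing_frameProj_v hG, pairing_comm G hG e v, pairing_comm G hG f v, h.ve, h.vf]

theorem IsFrame.pairing_tubeMap_e (u : ι → R) : pairing G (tubeMap G v e f u) e = 1 := by
  simp [tubeMap, pairing_sub_left, pairing_add_left, pairing_smul_left,
    h.pairing_frameProj_e hG, h.ee, pairing_comm G hG f e, h.ef]

theorem IsFrame.pairing_tubeMap_self [CharZero R] (u : ι → R) :
    pairing G (tubeMap G v e f u) (tubeMap G v e f u) = 0 := by
  simp only [tubeMap, pairing_sub_left, pairing_add_left, pairing_smul_left, pairing_sub_right,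
    pairing_add_right, pairing_smul_right, h.ee, h.ff, h.ef, pairing_comm G hG f e,
    h.pairing_frameProj_e hG, h.pairing_frameProj_f,
    pairing_comm G hG e (frameProj G v e f u), pairing_comm G hG f (frameProj G v e f u)]
  field_simp
  ring

/-- Such a z equals f + p + ⟨z, f⟩ e, with p its projection, and isotropy forces ⟨z, f⟩ = -⟨p, p⟩/2.
So nothing is lost by restricting to points in the image of `tubeMap`. -/
theorem IsFrame.tubeMap_eq_self [CharZero R] {z : ι → R} (hzz : pairing G z z = 0)
    (hze : pairing G z e = 1) (hzv : pairing G z v = 0) : tubeMap G v e f z = z := by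
  have h1 : frameProj G v e f z = z - pairing G z f • e - f := by
    simp [frameProj, hze, hzv]
  have h2 : pairing G (frameProj G v e f z) (frameProj G v e f z) = -2 * pairing G z f := by
    rw [h.pairing_frameProj hG, h1]
    simp only [pairing_sub_left, pairing_smul_left, hzz, pairing_comm G hG e z, hze,
      pairing_comm G hG f z]
    ring
  rw [tubeMap, h2, h1]
  ext i
  simp only [Pi.add_apply, Pi.sub_apply, Pi.smul_apply, smul_eq_mul]
  field_simp
  ring

end

end Projection

/-! ### Tube domains: convexity and comparison with the period cone. Parameters range over all of M
⊗ ℂ and are projected, so no basis of the complement is needed. -/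

section Tube

variable {ι : Type} [Fintype ι] {G : Matrix ι ι ℤ}

/-- The complex vector with given real coordinates. -/
def toComplex (x : ι → ℝ) : ι → ℂ := fun i => (x i : ℂ)

theorem pairing_toComplex (x y : ι → ℝ) :
    pairing G (toComplex x) (toComplex y) = ((pairing G x y : ℝ) : ℂ) := pairing_ofReal G x y

theorem IsFrame.toComplex {v e f : ι → ℝ} (h : IsFrame G v e f) :
    IsFrame G (toComplex v) (toComplex e) (toComplex f) where
  vv := by rw [pairing_toComplex]; exact_mod_cast h.vv
  ee := by rw [pairing_toComplex, h.ee, Complex.ofReal_zero]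
  ff := by rw [pairing_toComplex, h.ff, Complex.ofReal_zero]
  ef := by rw [pairing_toComplex, h.ef, Complex.ofReal_one]
  ve := by rw [pairing_toComplex, h.ve, Complex.ofReal_zero]
  vf := by rw [pairing_toComplex, h.vf, Complex.ofReal_zero]

theorem imPart_frameProj (hG : G.IsSymm) (v e f : ι → ℝ) (u : ι → ℂ) :
    imPart (frameProj G (toComplex v) (toComplex e) (toComplex f) u) =
      frameProj G v e f (imPart u) := by
  have h1 : ∀ x : ι → ℝ, (pairing G u (toComplex x)).im = pairing G (imPart u) x := fun x => by
    rw [pairing_comm G hG, pairing_comm G hG (imPart u)]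
    exact im_pairing_ofReal G x u
  have h2 : ∀ (c : ℂ) (x : ι → ℝ) (i : ι), (c * toComplex x i).im = c.im * x i := fun c x i =>
    Complex.im_mul_ofReal c (x i)
  ext i
  change (frameProj G (toComplex v) (toComplex e) (toComplex f) u i).im = _
  simp only [frameProj, Pi.sub_apply, Pi.smul_apply, smul_eq_mul, pairing_toComplex,
    Complex.sub_im, h2, Complex.div_ofReal_im, h1]
  rfl

/-- `e, f` is a hyperbolic pair, `y` is a negative vector orthogonal to it, and both are orthogonal
to the positive vector `v`. -/
structure IsTubeFrame (G : Matrix ι ι ℤ) (v e f y : ι → ℝ) : Prop extends IsFrame G v e f where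
  vpos : 0 < pairing G v v
  ye : pairing G y e = 0
  yf : pairing G y f = 0
  yv : pairing G y v = 0
  yy : pairing G y y < 0

/-- The tube domain: one of the two halves of the set of parameters of `tubeMap` whose image lies in
the period cone. -/
def tubeDomain (G : Matrix ι ι ℤ) (v e f y : ι → ℝ) : Set (ι → ℂ) :=
  {u | pairing G (frameProj G v e f (imPart u)) (frameProj G v e f (imPart u)) < 0 ∧
    pairing G (frameProj G v e f (imPart u)) y < 0}

/-- `tubeMap` with complex parameters, for a real frame. -/
def complexTubeMap (G : Matrix ι ι ℤ) (v e f : ι → ℝ) (u : ι → ℂ) : ι → ℂ :=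
  tubeMap G (toComplex v) (toComplex e) (toComplex f) u

theorem continuous_frameProj (v e f : ι → ℝ) :
    Continuous fun u : ι → ℝ => frameProj G v e f u := by
  have h : ∀ x : ι → ℝ, Continuous fun u : ι → ℝ => pairing G u x := fun x =>
    continuous_pairing G continuous_id continuous_const
  unfold frameProj
  have h1 := h e
  have h2 := h f
  have h3 := h v
  fun_prop

theorem isOpen_tubeDomain (v e f y : ι → ℝ) : IsOpen (tubeDomain G v e f y) := by
  have hc : Continuous fun u : ι → ℂ => frameProj G v e f (imPart u) :=
    (continuous_frameProj v e f).comp continuous_imPart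
  exact (isOpen_lt (continuous_pairing G hc hc) continuous_const).inter
    (isOpen_lt (continuous_pairing G hc continuous_const) continuous_const)

theorem differentiable_complexTubeMap (v e f : ι → ℝ) :
    Differentiable ℂ (complexTubeMap G v e f) := by
  have h : ∀ x : ι → ℂ, Differentiable ℂ fun u : ι → ℂ => pairing G u x := fun x =>
    differentiable_pairing G differentiable_id (differentiable_const _)
  have hp : Differentiable ℂ fun u : ι → ℂ =>
      frameProj G (toComplex v) (toComplex e) (toComplex f) u := by
    unfold frameProj
    have h1 := h (toComplex e)
    have h2 := h (toComplex f)
    have h3 := h (toComplex v)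
    have h4 : Differentiable ℂ fun u : ι → ℂ =>
        pairing G u (toComplex v) / pairing G (toComplex v) (toComplex v) := by
      simpa only [div_eq_mul_inv] using h3.mul_const _
    fun_prop
  have hpp := differentiable_pairing G hp hp
  have hpp2 := hpp.mul_const ((2 : ℂ)⁻¹)
  unfold complexTubeMap tubeMap
  simp only [div_eq_mul_inv]
  fun_prop

theorem IsTubeFrame.tubeDomain_nonempty {v e f y : ι → ℝ} (h : IsTubeFrame G v e f y) :
    (tubeDomain G v e f y).Nonempty := by
  refine ⟨Complex.I • toComplex y, ?_⟩
  have e1 : imPart (Complex.I • toComplex y) = y := by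
    ext i; simp [imPart, toComplex]
  rw [tubeDomain, Set.mem_ofPred_eq, e1, frameProj_of_orthogonal h.ye h.yf h.yv]
  exact ⟨h.yy, h.yy⟩

section

variable {v e f y : ι → ℝ} (hG : HasIndexTwo G) (h : IsTubeFrame G v e f y)
include hG h

/-- The vectors e - f and t span a negative definite plane orthogonal to w. -/
theorem IsTubeFrame.pos_of_orthogonal {t w : ι → ℝ} (ht : pairing G t t < 0)
    (hte : pairing G t e = 0) (htf : pairing G t f = 0) (hwe : pairing G w e = 0)
    (hwf : pairing G w f = 0) (hwt : pairing G w t = 0) : 0 ≤ pairing G w w := by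
  by_cases hw : w = 0
  · simp [hw, pairing_zero_left]
  refine (hG.pos (e - f) t w ?_ ht ?_ ?_ hwt hw).le
  · simp only [pairing_sub_left, pairing_sub_right, h.ee, h.ff, h.ef, pairing_comm G hG.symm f e]
    norm_num
  · rw [pairing_comm G hG.symm, pairing_sub_right, hte, htf, sub_zero]
  · rw [pairing_sub_right, hwe, hwf, sub_zero]

/-- In a Lorentzian space two vectors of the same half of the negative cone have negative product.
The combination s - c t orthogonal to y has nonnegative norm, and expanding that norm gives the
sign. -/
theorem IsTubeFrame.pairing_neg_of_neg {s t : ι → ℝ} (hse : pairing G s e = 0)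
    (hsf : pairing G s f = 0) (hte : pairing G t e = 0) (htf : pairing G t f = 0)
    (hs : pairing G s s < 0) (ht : pairing G t t < 0) (hsy : pairing G s y < 0)
    (hty : pairing G t y < 0) : pairing G s t < 0 := by
  set c := pairing G s y / pairing G t y with hc
  have hc0 : 0 < c := div_pos_of_neg_of_neg hsy hty
  have h1 := h.pos_of_orthogonal hG (t := y) (w := s - c • t) h.yy h.ye h.yf
    (by rw [pairing_sub_left, pairing_smul_left, hse, hte]; ring)
    (by rw [pairing_sub_left, pairing_smul_left, hsf, htf]; ring)
    (by rw [pairing_sub_left, pairing_smul_left, hc]; field_simp [hty.ne]; ring)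
  simp only [pairing_sub_left, pairing_sub_right, pairing_smul_left, pairing_smul_right,
    pairing_comm G hG.symm t s] at h1
  by_contra hcon
  have h2 := mul_nonneg hc0.le (not_lt.1 hcon)
  have h3 := mul_pos (mul_pos hc0 hc0) (neg_pos.2 ht)
  nlinarith

/-- The conditions say that the projected imaginary part lies in one half of a Lorentzian cone,
which is convex because the cross term is negative. -/
theorem IsTubeFrame.convex_tubeDomain : Convex ℝ (tubeDomain G v e f y) := by
  rintro s ⟨hs, hsy⟩ t ⟨ht, hty⟩ a b ha hb hab
  have e1 : imPart (a • s + b • t) = a • imPart s + b • imPart t := by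
    ext i; simp [imPart]
  have hst := h.pairing_neg_of_neg hG (h.pairing_frameProj_e hG.symm (imPart s))
    (h.pairing_frameProj_f (imPart s)) (h.pairing_frameProj_e hG.symm (imPart t))
    (h.pairing_frameProj_f (imPart t)) hs ht hsy hty
  rw [tubeDomain, Set.mem_ofPred_eq, e1, frameProj_add, frameProj_smul, frameProj_smul]
  simp only [pairing_add_left, pairing_add_right, pairing_smul_left, pairing_smul_right,
    pairing_comm G hG.symm (frameProj G v e f (imPart t)) (frameProj G v e f (imPart s))]
  rcases ha.eq_or_lt with rfl | ha
  · obtain rfl : b = 1 := by linarith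
    constructor <;> linarith
  · constructor
    · nlinarith [mul_nonneg hb hb, mul_pos ha ha, mul_nonneg ha.le hb,
        mul_pos_of_neg_of_neg (neg_neg_of_pos (mul_pos ha ha)) hs,
        mul_nonneg (mul_nonneg hb hb) (neg_pos.2 ht).le,
        mul_nonneg (mul_nonneg ha.le hb) (neg_pos.2 hst).le]
    · nlinarith [mul_pos ha (neg_pos.2 hsy), mul_nonneg hb (neg_pos.2 hty).le]

/-- With p the projection of u, the Hermitian norm of the image has real part ⟨p, p̄⟩ - Re ⟨p, p⟩ =
2⟨Im p, Im p⟩. -/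
theorem IsTubeFrame.complexTubeMap_mem_periodCone_iff (u : ι → ℂ) :
    complexTubeMap G v e f u ∈ periodCone G ↔
      pairing G (frameProj G v e f (imPart u)) (frameProj G v e f (imPart u)) < 0 := by
  have hC := h.toComplex
  have h1 : pairing G (complexTubeMap G v e f u) (complexTubeMap G v e f u) = 0 :=
    hC.pairing_tubeMap_self hG.symm u
  set p := frameProj G (toComplex v) (toComplex e) (toComplex f) u with hp
  set c := pairing G p p / 2 with hc
  have hstar : ∀ x : ι → ℝ, star (toComplex x) = toComplex x := fun x => by
    ext i; simp [toComplex]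
  have hps : ∀ x : ι → ℝ, pairing G p (toComplex x) = 0 → pairing G (toComplex x) (star p) = 0 := by
    intro x hx
    have := pairing_map G (starRingEnd ℂ) (toComplex x) p
    rw [pairing_comm G hG.symm (toComplex x) p, hx, map_zero] at this
    rw [← hstar x]
    exact this
  have h2 : pairing G (complexTubeMap G v e f u) (star (complexTubeMap G v e f u)) =
      pairing G p (star p) - (c + star c) := by
    have e1 : complexTubeMap G v e f u = toComplex f + p - c • toComplex e := rfl
    rw [e1, star_sub, star_add, star_smul, hstar, hstar]
    have hpe : pairing G p (toComplex e) = 0 := hC.pairing_frameProj_e hG.symm u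
    have hpf : pairing G p (toComplex f) = 0 := hC.pairing_frameProj_f u
    simp only [pairing_sub_left, pairing_sub_right, pairing_add_left, pairing_add_right,
      pairing_smul_left, pairing_smul_right, hC.ee, hC.ff, hC.ef,
      pairing_comm G hG.symm (toComplex f) (toComplex e), hpe, hpf, hps e hpe, hps f hpf]
    ring
  have h3 : (pairing G (complexTubeMap G v e f u) (star (complexTubeMap G v e f u))).re =
      2 * pairing G (imPart p) (imPart p) := by
    have hcc : (c + star c).re = (pairing G p p).re := by
      rw [hc]
      simp
    rw [h2, Complex.sub_re, hcc, pairing_star_self G hG.symm, pairing_self_eq G hG.symm]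
    simp
    ring
  rw [periodCone, Set.mem_ofPred_eq, h3, ← imPart_frameProj hG.symm]
  simp only [h1, true_and]
  constructor <;> intro h <;> linarith

theorem IsTubeFrame.complexTubeMap_mem {u : ι → ℂ} (hu : u ∈ tubeDomain G v e f y) :
    complexTubeMap G v e f u ∈ periodCone G :=
  (h.complexTubeMap_mem_periodCone_iff hG u).2 hu.1

theorem IsTubeFrame.pairing_complexTubeMap (u : ι → ℂ) :
    pairing G (toComplex v) (complexTubeMap G v e f u) = 0 := by
  rw [pairing_comm G hG.symm]
  exact h.toComplex.pairing_tubeMap_v hG.symm u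

/-- Every point of `v^⊥` in the period cone is, up to scaling, in the image of the tube domain or of
its opposite. -/
theorem IsTubeFrame.exists_complexTubeMap_eq {z : ι → ℂ} (hz : z ∈ periodCone G)
    (hzv : pairing G (toComplex v) z = 0) : ∃ (a : ℂ) (u : ι → ℂ), a ≠ 0 ∧
      (u ∈ tubeDomain G v e f y ∨ -u ∈ tubeDomain G v e f y) ∧
      complexTubeMap G v e f u = a • z := by
  classical
  have hC := h.toComplex
  -- An isotropic real vector is never orthogonal to a period, so z can be scaled to have product 1
  -- with e.
  have hze : pairing G (toComplex e) z ≠ 0 := by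
    intro h0
    have hne : e ≠ 0 := by
      rintro rfl
      have := h.ef
      simp [pairing_zero_left] at this
    exact (hG.pos_of_periodCone hz hne h0).ne' h.ee
  set a := (pairing G (toComplex e) z)⁻¹ with ha
  have ha0 : a ≠ 0 := inv_ne_zero hze
  have haz := smul_mem_periodCone G ha0 hz
  have hφ : complexTubeMap G v e f (a • z) = a • z := by
    refine hC.tubeMap_eq_self hG.symm haz.1 ?_ ?_
    · rw [pairing_comm G hG.symm, pairing_smul_right, ha, inv_mul_cancel₀ hze]
    · rw [pairing_comm G hG.symm, pairing_smul_right, hzv, mul_zero]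
  refine ⟨a, a • z, ha0, ?_, hφ⟩
  rw [← hφ] at haz
  have hneg := (h.complexTubeMap_mem_periodCone_iff hG _).1 haz
  set q := frameProj G v e f (imPart (a • z)) with hq
  have hqy : pairing G q y ≠ 0 := by
    intro h0
    have := h.pos_of_orthogonal hG (t := y) (w := q) h.yy h.ye h.yf
      (h.pairing_frameProj_e hG.symm _) (h.pairing_frameProj_f _) h0
    linarith
  have himneg : imPart (-(a • z)) = -imPart (a • z) := by ext i; simp [imPart]
  rcases lt_or_gt_of_ne hqy with hlt | hgt
  · exact Or.inl ⟨hneg, hlt⟩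
  · refine Or.inr ?_
    rw [tubeDomain, Set.mem_ofPred_eq, himneg, frameProj_neg, ← hq]
    simp only [pairing_neg_left, pairing_neg_right]
    constructor <;> linarith

/-- A vector orthogonal to the whole quadric cone in `v^⊥` and of the same norm as `v` is `± v`. -/
theorem IsTubeFrame.eq_or_eq_neg {v' : ι → ℝ} (hnorm : pairing G v' v' = pairing G v v)
    (horth : ∀ u, pairing G (toComplex v') (complexTubeMap G v e f u) = 0) :
    v' = v ∨ v' = -v := by
  have hreal : ∀ u : ι → ℝ, pairing G v' (tubeMap G v e f u) = 0 := by
    intro u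
    have e1 : complexTubeMap G v e f (toComplex u) = toComplex (tubeMap G v e f u) := by
      have e2 : frameProj G (toComplex v) (toComplex e) (toComplex f) (toComplex u) =
          toComplex (frameProj G v e f u) := by
        ext i
        simp only [frameProj, pairing_toComplex]
        simp [toComplex]
      ext i
      simp only [complexTubeMap, tubeMap, e2, pairing_toComplex]
      simp [toComplex]
    have := horth (toComplex u)
    rw [e1, pairing_toComplex] at this
    exact_mod_cast this
  have hp0 : frameProj G v e f (0 : ι → ℝ) = 0 :=
    frameProj_of_orthogonal (pairing_zero_left G _) (pairing_zero_left G _) (pairing_zero_left G _)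
  -- The parameter 0 maps to f.
  have hf0 : pairing G v' f = 0 := by
    have := hreal 0
    rwa [tubeMap, hp0, pairing_zero_left, zero_div, zero_smul, add_zero, sub_zero] at this
  have hexp : ∀ u : ι → ℝ, pairing G v' (frameProj G v e f u) -
      pairing G (frameProj G v e f u) (frameProj G v e f u) / 2 * pairing G v' e = 0 := by
    intro u
    have := hreal u
    rwa [tubeMap, pairing_sub_right, pairing_add_right, pairing_smul_right, hf0, zero_add] at this
  -- Adding the relations for y and -y isolates the quadratic term, with coefficient ⟨y, y⟩ ≠ 0.
  have he0 : pairing G v' e = 0 := by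
    have h1 := hexp y
    have h2 := hexp (-y)
    rw [frameProj_neg, frameProj_of_orthogonal h.ye h.yf h.yv, pairing_neg_right,
      pairing_neg_right, pairing_neg_left] at h2
    rw [frameProj_of_orthogonal h.ye h.yf h.yv] at h1
    have h3 : pairing G y y * pairing G v' e = 0 := by linarith
    exact (mul_eq_zero.1 h3).resolve_left h.yy.ne
  have hp : ∀ u : ι → ℝ, pairing G v' (frameProj G v e f u) = 0 := fun u => by
    simpa [he0] using hexp u
  set r := frameProj G v e f v' with hr
  have hrad : ∀ u, pairing G r u = 0 := fun u => by
    rw [← h.pairing_frameProj hG.symm, pairing_comm G hG.symm, h.pairing_frameProj hG.symm,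
      pairing_comm G hG.symm, hp]
  -- A nonzero radical vector would have positive norm, being orthogonal to the negative plane of e
  -- - f and y.
  have hr0 : r = 0 := by
    by_contra hne
    refine (hG.pos (e - f) y r ?_ h.yy ?_ (hrad _) (hrad _) hne).ne' (hrad r)
    · simp only [pairing_sub_left, pairing_sub_right, h.ee, h.ff, h.ef, pairing_comm G hG.symm f e]
      norm_num
    · rw [pairing_comm G hG.symm, pairing_sub_right, h.ye, h.yf, sub_zero]
  rw [hr0, frameProj, he0, hf0, zero_smul, zero_smul, sub_zero, sub_zero] at hr
  have hv' : v' = (pairing G v' v / pairing G v v) • v := (sub_eq_zero.1 hr.symm)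
  set c := pairing G v' v / pairing G v v with hc
  rw [hv', pairing_smul_left, pairing_smul_right] at hnorm
  have hcc : c * c = 1 := by
    have h2 : (c * c - 1) * pairing G v v = 0 := by linarith
    have := (mul_eq_zero.1 h2).resolve_right h.vv
    linarith
  rcases mul_self_eq_one_iff.1 hcc with h1 | h1
  · left; rw [hv', h1, one_smul]
  · right; rw [hv', h1, neg_one_smul]

end

end Tube

/-! ### The monodromy involution exchanging the two halves. -/

section Involution

theorem map_intCast_int {ι : Type} (G : Matrix ι ι ℤ) : G.map (Int.cast : ℤ → ℤ) = G := by
  ext; simp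

theorem pairing_int {ι : Type} [Fintype ι] (G : Matrix ι ι ℤ) (x y : ι → ℤ) :
    pairing G x y = x ⬝ᵥ (G *ᵥ y) := by
  rw [pairing, map_intCast_int]

variable {ι : Type} [Fintype ι] [DecidableEq ι] {G : Matrix ι ι ℤ}

/-- The matrix of `x ↦ x - 2⟨x, f⟩e - 2⟨x, e⟩f`, which is `-1` on a hyperbolic pair `e, f` and `1` on
its orthogonal complement. -/
def hyperbolicNegMatrix (G : Matrix ι ι ℤ) (e f : ι → ℤ) : Matrix ι ι ℤ :=
  1 - Matrix.of fun i k => 2 * (e i * (G *ᵥ f) k + f i * (G *ᵥ e) k)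

theorem hyperbolicNegMatrix_mulVec {R : Type} [CommRing R] (e f : ι → ℤ)
    (z : ι → R) : (hyperbolicNegMatrix G e f).map (Int.cast : ℤ → R) *ᵥ z =
      z - (2 * pairing G z (fun i => (f i : R))) • (fun i => (e i : R)) -
        (2 * pairing G z (fun i => (e i : R))) • (fun i => (f i : R)) := by
  have hsum : ∀ y : ι → ℤ, pairing G z (fun i => (y i : R)) =
      ∑ k, (((G *ᵥ y) k : ℤ) : R) * z k := by
    intro y
    simp [pairing, dotProduct, Matrix.mulVec, mul_comm]
  ext i
  have h1 : ((hyperbolicNegMatrix G e f).map (Int.cast : ℤ → R) *ᵥ z) i =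
      ∑ k, (((1 : Matrix ι ι ℤ) i k : ℤ) : R) * z k -
        ∑ k, ((2 * (e i : R)) * ((((G *ᵥ f) k : ℤ) : R) * z k) +
          (2 * (f i : R)) * ((((G *ᵥ e) k : ℤ) : R) * z k)) := by
    rw [← Finset.sum_sub_distrib]
    refine Finset.sum_congr rfl fun k _ => ?_
    simp only [hyperbolicNegMatrix, Matrix.map_apply, Matrix.sub_apply, Matrix.of_apply]
    push_cast
    ring
  rw [h1, Finset.sum_add_distrib, ← Finset.mul_sum, ← Finset.mul_sum, ← hsum, ← hsum]
  simp [Matrix.one_apply]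
  ring

theorem hyperbolicNegMatrix_mulVec_int (e f z : ι → ℤ) :
    hyperbolicNegMatrix G e f *ᵥ z =
      z - (2 * pairing G z f) • e - (2 * pairing G z e) • f := by
  have := hyperbolicNegMatrix_mulVec (G := G) e f z
  rw [map_intCast_int] at this
  exact this

theorem hyperbolicNegMatrix_mul_self (hG : G.IsSymm) {e f : ι → ℤ} (hee : pairing G e e = 0)
    (hff : pairing G f f = 0) (hef : pairing G e f = 1) :
    hyperbolicNegMatrix G e f * hyperbolicNegMatrix G e f = 1 := by
  refine Matrix.ext_iff_mulVec.2 fun z => ?_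
  rw [← Matrix.mulVec_mulVec, hyperbolicNegMatrix_mulVec_int, hyperbolicNegMatrix_mulVec_int]
  simp only [pairing_sub_left, pairing_smul_left, hee, hff, hef, pairing_comm G hG f e,
    Matrix.one_mulVec]
  ext i
  simp only [Pi.sub_apply, Pi.smul_apply, smul_eq_mul]
  ring

/-- The isometry which is `-1` on a hyperbolic pair and `1` on its orthogonal complement. -/
def hyperbolicNeg (hG : G.IsSymm) {e f : ι → ℤ} (hee : pairing G e e = 0)
    (hff : pairing G f f = 0) (hef : pairing G e f = 1) : GL ι ℤ :=
  ⟨hyperbolicNegMatrix G e f, hyperbolicNegMatrix G e f, hyperbolicNegMatrix_mul_self hG hee hff hef,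
    hyperbolicNegMatrix_mul_self hG hee hff hef⟩

variable (hG : G.IsSymm) {e f : ι → ℤ} (hee : pairing G e e = 0)
    (hff : pairing G f f = 0) (hef : pairing G e f = 1)

theorem act_hyperbolicNeg {R : Type} [CommRing R] (z : ι → R) :
    act (hyperbolicNeg hG hee hff hef) z =
      z - (2 * pairing G z (fun i => (f i : R))) • (fun i => (e i : R)) -
        (2 * pairing G z (fun i => (e i : R))) • (fun i => (f i : R)) :=
  hyperbolicNegMatrix_mulVec e f z

/-- It changes a dual vector by integral multiples of e and f, hence acts trivially on the
discriminant group. -/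
theorem hyperbolicNeg_mem : hyperbolicNeg hG hee hff hef ∈ monodromyGroup G := by
  constructor
  · change (hyperbolicNegMatrix G e f)ᵀ * G * hyperbolicNegMatrix G e f = G
    have key : ∀ x y : ι → ℤ, x ⬝ᵥ (((hyperbolicNegMatrix G e f)ᵀ * G *
        hyperbolicNegMatrix G e f) *ᵥ y) = x ⬝ᵥ (G *ᵥ y) := by
      intro x y
      have h1 : x ⬝ᵥ (((hyperbolicNegMatrix G e f)ᵀ * G * hyperbolicNegMatrix G e f) *ᵥ y) =
          pairing G (hyperbolicNegMatrix G e f *ᵥ x) (hyperbolicNegMatrix G e f *ᵥ y) := by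
        rw [pairing_int, ← Matrix.mulVec_mulVec, ← Matrix.mulVec_mulVec, Matrix.dotProduct_mulVec,
          Matrix.vecMul_transpose]
      have h2 : x ⬝ᵥ (G *ᵥ y) = pairing G x y := (pairing_int G x y).symm
      rw [h1, h2, hyperbolicNegMatrix_mulVec_int, hyperbolicNegMatrix_mulVec_int]
      simp only [pairing_sub_left, pairing_sub_right, pairing_smul_left, pairing_smul_right, hee, hff,
        hef, pairing_comm G hG f e, pairing_comm G hG e y, pairing_comm G hG f y]
      ring
    ext i k
    simpa using key (Pi.single i 1) (Pi.single k 1)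
  · intro v hv
    obtain ⟨a, ha⟩ := hv f
    obtain ⟨b, hb⟩ := hv e
    refine ⟨(-(2 * a)) • e + (-(2 * b)) • f, ?_⟩
    rw [act_hyperbolicNeg, ha, hb]
    ext i
    simp only [Pi.sub_apply, Pi.smul_apply, Pi.add_apply, smul_eq_mul]
    push_cast
    ring

end Involution

/-! ### Irreducibility and maximality of the image of v^⊥. -/

section Components

theorem hyperplaneSection_iff_real {ι : Type} [Fintype ι] {G : Matrix ι ι ℤ} {v : ι → ℚ} {w : periodDomain G} {z : ι → ℂ} (hz : z ≠ 0)
    (hw : Projectivization.mk ℂ z hz = (w : ℙ ℂ (ι → ℂ))) :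
    w ∈ hyperplaneSection G v ↔ pairing G (toComplex fun i => (v i : ℝ)) z = 0 := by
  rw [mem_hyperplaneSection_iff hz hw, show (toComplex fun i => (v i : ℝ)) = fun i => (v i : ℂ) by
    ext i; simp [toComplex]]

theorem hyperplaneSection_neg {ι : Type} [Fintype ι] {G : Matrix ι ι ℤ} (v : ι → ℚ) :
    hyperplaneSection G (-v) = hyperplaneSection G v := by
  ext w
  rw [mem_hyperplaneSection_iff _ (mk_rep_eq w), mem_hyperplaneSection_iff _ (mk_rep_eq w),
    show (fun i => (((-v) i : ℚ) : ℂ)) = -fun i => ((v i : ℚ) : ℂ) by ext i; simp,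
    pairing_neg_left, neg_eq_zero]

/-- The image of the tube domain in the period domain. -/
def tubeImage {ι : Type} [Fintype ι] (G : Matrix ι ι ℤ) (v e f y : ι → ℝ) : Set (periodDomain G) :=
  {w | ∃ u ∈ tubeDomain G v e f y, ∃ h : complexTubeMap G v e f u ≠ 0,
    Projectivization.mk ℂ _ h = (w : ℙ ℂ (ι → ℂ))}

theorem IsTubeFrame.tubeImage_subset_hyperplaneSection {ι : Type} [Fintype ι]
    {G : Matrix ι ι ℤ} (hG : HasIndexTwo G) {v : ι → ℚ}
    {e f y : ι → ℝ} (h : IsTubeFrame G (fun i => (v i : ℝ)) e f y) :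
    tubeImage G (fun i => (v i : ℝ)) e f y ⊆ hyperplaneSection G v := by
  rintro w ⟨u, hu, hne, hw⟩
  exact (hyperplaneSection_iff_real hne hw).2 (h.pairing_complexTubeMap hG u)

variable {ι : Type} [Fintype ι] [DecidableEq ι] {G : Matrix ι ι ℤ}

/-- The point of the period domain with a given parameter in the tube domain. -/
def tubePoint (hG : HasIndexTwo G) {v e f y : ι → ℝ} (h : IsTubeFrame G v e f y) {u : ι → ℂ}
    (hu : u ∈ tubeDomain G v e f y) : periodDomain G :=
  ⟨Projectivization.mk ℂ _ (ne_zero_of_mem_periodCone (h.complexTubeMap_mem hG hu)),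
    (mk_mem_periodDomain G _).2 (h.complexTubeMap_mem hG hu)⟩

/-- The set of parameters in the tube domain whose image lies in `A`. -/
def tubePreimage (hG : HasIndexTwo G) {v e f y : ι → ℝ} (h : IsTubeFrame G v e f y)
    (A : Set (periodDomain G)) : Set (ι → ℂ) :=
  {u | ∃ hu : u ∈ tubeDomain G v e f y, tubePoint hG h hu ∈ A}

theorem IsTubeFrame.tubePoint_mem (hG : HasIndexTwo G) {v : ι → ℚ} {e f y : ι → ℝ}
    (h : IsTubeFrame G (fun i => (v i : ℝ)) e f y) {u : ι → ℂ}
    (hu : u ∈ tubeDomain G (fun i => (v i : ℝ)) e f y) :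
    tubePoint hG h hu ∈ hyperplaneSection G v :=
  (hyperplaneSection_iff_real _ rfl).2 (h.pairing_complexTubeMap hG u)

/-- Local equations pull back along the holomorphic map `complexTubeMap`. -/
theorem IsTubeFrame.isLocallyAnalyticOn (hG : HasIndexTwo G) {v e f y : ι → ℝ}
    (h : IsTubeFrame G v e f y) {A : Set (periodDomain G)} (hA : IsAnalyticInDomain G A) :
    IsLocallyAnalyticOn (tubeDomain G v e f y) (tubePreimage hG h A) := by
  intro u hu
  obtain ⟨U, hU, hzU, k, g, hg, hgA⟩ := hA _ (h.complexTubeMap_mem hG hu)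
  have hd := differentiable_complexTubeMap (G := G) v e f
  refine ⟨complexTubeMap G v e f ⁻¹' U, hU.preimage hd.continuous, hzU, k,
    fun i => g i ∘ complexTubeMap G v e f,
    fun i => (hg i).comp hd.differentiableOn fun _ h => h, ?_⟩
  rintro q ⟨hqU, hq⟩
  refine Iff.trans ?_ (hgA (tubePoint hG h hq) _ _ hqU rfl)
  exact ⟨fun ⟨_, h⟩ => h, fun h => ⟨hq, h⟩⟩

theorem IsTubeFrame.tubeDomain_subset_tubePreimage_iff (hG : HasIndexTwo G) {v e f y : ι → ℝ}
    (h : IsTubeFrame G v e f y) (C : Set (periodDomain G)) :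
    tubeDomain G v e f y ⊆ tubePreimage hG h C ↔ tubeImage G v e f y ⊆ C := by
  constructor
  · rintro hC w ⟨u, hu, hne, hw⟩
    obtain ⟨hu', hmem⟩ := hC hu
    have : tubePoint hG h hu' = w := Subtype.ext hw
    exact this ▸ hmem
  · intro hC u hu
    exact ⟨hu, hC ⟨u, hu, _, rfl⟩⟩

theorem IsTubeFrame.tubeImage_subset_or_subset (hG : HasIndexTwo G) {v e f y : ι → ℝ}
    (h : IsTubeFrame G v e f y) {A B : Set (periodDomain G)}
    (hA : IsAnalyticInDomain G A) (hB : IsAnalyticInDomain G B)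
    (hAB : tubeImage G v e f y ⊆ A ∪ B) :
    tubeImage G v e f y ⊆ A ∨ tubeImage G v e f y ⊆ B := by
  rw [← h.tubeDomain_subset_tubePreimage_iff hG, ← h.tubeDomain_subset_tubePreimage_iff hG]
  refine IsLocallyAnalyticOn.subset_or_subset (isOpen_tubeDomain _ _ _ _)
    (h.convex_tubeDomain hG) (h.isLocallyAnalyticOn hG hA) (h.isLocallyAnalyticOn hG hB) ?_
  intro u hu
  rcases hAB (a := tubePoint hG h hu) ⟨u, hu, _, rfl⟩ with h1 | h1
  · exact Or.inl ⟨hu, h1⟩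
  · exact Or.inr ⟨hu, h1⟩

/-- Every point of `v^⊥` is equivalent under the monodromy group to a point of the image of the tube
domain. -/
theorem IsTubeFrame.periodProj_hyperplaneSection (hG : HasIndexTwo G) {v : ι → ℚ} {e f : ι → ℤ}
    {y : ι → ℝ} (h : IsTubeFrame G (fun i => (v i : ℝ)) (fun i => (e i : ℝ)) (fun i => (f i : ℝ)) y) :
    periodProj G '' hyperplaneSection G v ⊆ periodProj G ''
      tubeImage G (fun i => (v i : ℝ)) (fun i => (e i : ℝ)) (fun i => (f i : ℝ)) y := by
  have hee : pairing G e e = 0 := by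
    have := h.ee; rw [pairing_intCast] at this; exact_mod_cast this
  have hff : pairing G f f = 0 := by
    have := h.ff; rw [pairing_intCast] at this; exact_mod_cast this
  have hef : pairing G e f = 1 := by
    have := h.ef; rw [pairing_intCast] at this; exact_mod_cast this
  have hC := h.toComplex
  set v' : ι → ℝ := fun i => (v i : ℝ)
  set e' : ι → ℝ := fun i => (e i : ℝ) with he'
  set f' : ι → ℝ := fun i => (f i : ℝ) with hf'
  rintro _ ⟨w, hw, rfl⟩
  obtain ⟨a, u, ha, hu, hφ⟩ := h.exists_complexTubeMap_eq hG (rep_mem_periodCone w)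
    ((hyperplaneSection_iff_real _ (mk_rep_eq w)).1 hw)
  have hcone : complexTubeMap G v' e' f' u ∈ periodCone G := by
    rw [hφ]; exact smul_mem_periodCone G ha (rep_mem_periodCone w)
  have hne := ne_zero_of_mem_periodCone hcone
  have hmk : Projectivization.mk ℂ _ hne = (w : ℙ ℂ (ι → ℂ)) := by
    rw [← mk_rep_eq w]
    exact (Projectivization.mk_eq_mk_iff' ℂ _ _ _ _).2 ⟨a, hφ.symm⟩
  rcases hu with hu | hu
  · exact ⟨w, ⟨u, hu, hne, hmk⟩, rfl⟩
  · refine ⟨tubePoint hG h hu, ⟨-u, hu, _, rfl⟩, ?_⟩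
    refine (periodProj_eq_iff _ _).2
      ⟨⟨hyperbolicNeg hG.symm hee hff hef, hyperbolicNeg_mem hG.symm hee hff hef⟩, ?_⟩
    refine Subtype.ext ?_
    change hyperbolicNeg hG.symm hee hff hef • (w : ℙ ℂ (ι → ℂ)) = Projectivization.mk ℂ _ _
    rw [← hmk, smul_mk_eq]
    -- The involution sends f + p - (⟨p, p⟩/2) e to -(f - p - (⟨p, p⟩/2) e), the negative of the
    -- point with parameter -u.
    refine (Projectivization.mk_eq_mk_iff' ℂ _ _ _ _).2 ⟨-1, ?_⟩
    have e1 : (fun i => (e i : ℂ)) = toComplex e' := by ext i; simp [toComplex, e']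
    have f1 : (fun i => (f i : ℂ)) = toComplex f' := by ext i; simp [toComplex, f']
    rw [act_hyperbolicNeg, e1, f1]
    simp only [complexTubeMap, hC.pairing_tubeMap_f, hC.pairing_tubeMap_e hG.symm]
    rw [tubeMap, tubeMap, frameProj_neg]
    simp only [pairing_neg_left, pairing_neg_right]
    ext i
    simp only [Pi.sub_apply, Pi.smul_apply, Pi.add_apply, Pi.neg_apply, smul_eq_mul]
    ring

/-- S is countable, so by Baire one form s vanishes on an open set of parameters, hence on all of
them; equality of norms then gives s = ±v. -/
theorem IsTubeFrame.eq_or_eq_neg_of_subset_arrangement (hG : HasIndexTwo G) {v : ι → ℚ}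
    {e f y : ι → ℝ} (h : IsTubeFrame G (fun i => (v i : ℝ)) e f y) {S : Set (ι → ℚ)}
    (hS : ∀ u ∈ S, pairing G u u = pairing G v v)
    (hvS : hyperplaneSection G v ⊆ arrangement G S) : v ∈ S ∨ -v ∈ S := by
  set v' : ι → ℝ := fun i => (v i : ℝ)
  let F : (ι → ℚ) → (ι → ℂ) → ℂ := fun s u =>
    pairing G (toComplex fun i => (s i : ℝ)) (complexTubeMap G v' e f u)
  have hFd : ∀ s, Differentiable ℂ (F s) := fun s =>
    differentiable_pairing G (differentiable_const _) (differentiable_complexTubeMap v' e f)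
  have hex : ∃ s ∈ S, (interior {u | F s u = 0}).Nonempty := by
    by_contra hcon
    push Not at hcon
    -- If every zero set had empty interior, a parameter in the tube domain would avoid all of S.
    have hdense : Dense (⋂ s ∈ S, {u | F s u = 0}ᶜ) := by
      refine dense_biInter_of_isOpen (fun s _ => ?_) (Set.to_countable S) fun s hs => ?_
      · exact (isClosed_eq (hFd s).continuous continuous_const).isOpen_compl
      · exact interior_eq_empty_iff_dense_compl.1 (hcon s hs)
    obtain ⟨u, hu, hu'⟩ := hdense.inter_open_nonempty _ (isOpen_tubeDomain v' e f y)
      h.tubeDomain_nonempty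
    have h1 := hvS (h.tubePoint_mem hG hu)
    simp only [arrangement, Set.mem_iUnion, exists_prop] at h1
    obtain ⟨s, hs, hsu⟩ := h1
    exact (Set.mem_iInter₂.1 hu' s hs) ((hyperplaneSection_iff_real _ rfl).1 hsu)
  obtain ⟨s, hs, q, hq⟩ := hex
  have horth : ∀ u, F s u = 0 := fun u =>
    eq_zero_of_eventuallyEq_zero_of_convex isOpen_univ convex_univ (hFd s).differentiableOn
      (Set.mem_univ q) (mem_interior_iff_mem_nhds.1 hq) (Set.mem_univ u)
  have hnorm : pairing G (fun i => (s i : ℝ)) (fun i => (s i : ℝ)) = pairing G v' v' := by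
    rw [pairing_ratCast_real, hS s hs, ← pairing_ratCast_real]
  rcases h.eq_or_eq_neg hG hnorm horth with h1 | h1
  · left
    rwa [show v = s from funext fun i => by
      have := congrFun h1 i
      simp only [v'] at this
      exact_mod_cast this.symm]
  · right
    rwa [show -v = s from funext fun i => by
      have := congrFun h1 i
      simp only [v', Pi.neg_apply] at this
      rw [Pi.neg_apply]
      exact_mod_cast this.symm]

theorem mem_monodromyOrbit_of_act_mem {g : GL ι ℤ} (hg : g ∈ monodromyGroup G) {v u : ι → ℚ}
    (h : act g u ∈ monodromyOrbit G v) : u ∈ monodromyOrbit G v := by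
  obtain ⟨g', hg', he⟩ := h
  refine ⟨g⁻¹ * g', mul_mem (inv_mem hg) hg', ?_⟩
  rw [act_mul, he, ← act_mul, inv_mul_cancel, act_one]

/-- If `v` is a vector of the dual lattice orthogonal to a hyperbolic pair of the lattice, then the
image of `v^⊥` in the period space is irreducible, and it is a component of the Heegner divisor
attached to the norm and the class of `v`. -/
theorem IsTubeFrame.isComponent (hG : HasIndexTwo G) {v : dualLattice G} {e f : ι → ℤ} {y : ι → ℝ}
    (h : IsTubeFrame G (fun i => ((v : ι → ℚ) i : ℝ)) (fun i => (e i : ℝ)) (fun i => (f i : ℝ)) y)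
    {n : ℚ} (hn : 1 / 2 * pairing G (v : ι → ℚ) v = n) :
    periodProj G '' hyperplaneSection G v ⊆ heegnerDivisor G n (discriminantClass G v) ∧
      IsComponent G (periodProj G '' hyperplaneSection G v)
        (heegnerDivisor G n (discriminantClass G v)) := by
  have hsub : periodProj G '' hyperplaneSection G v ⊆
      heegnerDivisor G n (discriminantClass G v) := by
    refine Set.image_mono ?_
    exact Set.subset_biUnion_of_mem (u := fun v : dualLattice G => hyperplaneSection G v) ⟨rfl, hn⟩
  have hZan : IsAnalytic G (periodProj G '' hyperplaneSection G v) := by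
    rw [← image_arrangement_monodromyOrbit]
    exact hG.isAnalytic_image_arrangement (fun u hu => monodromyOrbit_norm v.2 hu)
      (isStable_monodromyOrbit _)
  refine ⟨hsub, ⟨⟨hZan, ?_, ?_⟩, hsub⟩, ?_⟩
  · obtain ⟨u, hu⟩ := h.tubeDomain_nonempty
    exact ⟨_, _, h.tubePoint_mem hG hu, rfl⟩
  · intro A B hA hB hAB
    have hcover : hyperplaneSection G (v : ι → ℚ) ⊆ periodProj G ⁻¹' A ∪ periodProj G ⁻¹' B := by
      rw [← Set.preimage_union, ← hAB]
      exact Set.subset_preimage_image _ _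
    have himg := h.periodProj_hyperplaneSection hG
    -- Containing one half is enough, since the image of that half is already the image of all of
    -- v^⊥.
    rcases h.tubeImage_subset_or_subset hG hA hB
      ((h.tubeImage_subset_hyperplaneSection hG).trans hcover) with h1 | h1
    · refine Or.inl (Set.Subset.antisymm (himg.trans (Set.image_subset_iff.2 h1)) ?_)
      rw [hAB]; exact Set.subset_union_left
    · refine Or.inr (Set.Subset.antisymm (himg.trans (Set.image_subset_iff.2 h1)) ?_)
      rw [hAB]; exact Set.subset_union_right
  · rintro T ⟨⟨hTan, -, hTirr⟩, hTY⟩ hZT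
    -- The rest of the Heegner divisor. Both orbits are removed because v and -v have the same
    -- hyperplane section but may lie in different orbits.
    let S : Set (ι → ℚ) := {u | ∃ hu : u ∈ dualLattice G,
      discriminantClass G ⟨u, hu⟩ = discriminantClass G v ∧ 1 / 2 * pairing G u u = n ∧
        u ∉ monodromyOrbit G (v : ι → ℚ) ∧ u ∉ monodromyOrbit G (-(v : ι → ℚ))}
    have hSn : ∀ u ∈ S, u ∈ dualLattice G ∧ pairing G u u = 2 * n := by
      rintro u ⟨hu, -, hun, -⟩
      exact ⟨hu, by linarith⟩
    have hSst : IsStable G S := by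
      rintro g hg u ⟨hu, hcl, hun, h1, h2⟩
      refine ⟨act_mem_dualLattice hg hu, ?_, ?_, fun h3 => h1 (mem_monodromyOrbit_of_act_mem hg h3),
        fun h3 => h2 (mem_monodromyOrbit_of_act_mem hg h3)⟩
      · rw [← hcl]
        refine (QuotientAddGroup.eq_iff_sub_mem).2 ?_
        rw [AddSubgroup.mem_addSubgroupOf]
        exact hg.2 u hu
      · rw [pairing_act G hg, hun]
    have hSan := hG.isAnalytic_image_arrangement hSn hSst
    have hT : T = (T ∩ periodProj G '' hyperplaneSection G v) ∪
        (T ∩ periodProj G '' arrangement G S) := by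
      rw [← Set.inter_union_distrib_left, eq_comm, Set.inter_eq_left]
      intro t ht
      obtain ⟨w, hw, rfl⟩ := hTY ht
      simp only [Set.mem_iUnion, exists_prop, Set.mem_ofPred_eq] at hw
      obtain ⟨u, ⟨hcl, hun⟩, hwu⟩ := hw
      by_cases h1 : (u : ι → ℚ) ∈ monodromyOrbit G (v : ι → ℚ)
      · left
        rw [← image_arrangement_monodromyOrbit]
        exact ⟨w, Set.mem_biUnion h1 hwu, rfl⟩
      by_cases h2 : (u : ι → ℚ) ∈ monodromyOrbit G (-(v : ι → ℚ))
      · left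
        rw [← hyperplaneSection_neg, ← image_arrangement_monodromyOrbit]
        exact ⟨w, Set.mem_biUnion h2 hwu, rfl⟩
      · right
        refine ⟨w, Set.mem_biUnion (show (u : ι → ℚ) ∈ S from ⟨u.2, hcl, hun, h1, h2⟩) hwu, rfl⟩
    rcases hTirr _ _ (hTan.inter hZan) (hTan.inter hSan) hT with h1 | h1
    · exact Set.inter_eq_left.1 h1.symm
    · exfalso
      -- Stability of S lifts the inclusion of images back to Ω.
      have h2 : hyperplaneSection G (v : ι → ℚ) ⊆ arrangement G S := by
        rw [← hSst.preimage_image, ← Set.image_subset_iff]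
        exact Set.Subset.trans hZT (Set.inter_eq_left.1 h1.symm)
      rcases h.eq_or_eq_neg_of_subset_arrangement hG
        (fun u hu => by rw [(hSn u hu).2]; linarith) h2 with h3 | h3
      · obtain ⟨_, -, -, h4, -⟩ := h3
        exact h4 (self_mem_monodromyOrbit _)
      · obtain ⟨_, -, -, -, h4⟩ := h3
        exact h4 (self_mem_monodromyOrbit _)

end Components

/-! ### Euclid's algorithm in U ⊕ U. -/

section HyperbolicPlanes

/-- The form of `U ⊕ U` on `ℤ⁴`. -/
def doubleHyperbolic (x y : Fin 4 → ℤ) : ℤ := x 0 * y 1 + x 1 * y 0 + x 2 * y 3 + x 3 * y 2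

/-- `v ∈ U ⊕ U` is orthogonal to a hyperbolic pair whose complement in `U ⊕ U` contains a negative
vector. -/
def HasOrthogonalPair (v : Fin 4 → ℤ) : Prop :=
  ∃ e f x : Fin 4 → ℤ, doubleHyperbolic e e = 0 ∧ doubleHyperbolic f f = 0 ∧
    doubleHyperbolic e f = 1 ∧ doubleHyperbolic x e = 0 ∧ doubleHyperbolic x f = 0 ∧
    doubleHyperbolic x x < 0 ∧ doubleHyperbolic v e = 0 ∧ doubleHyperbolic v f = 0

theorem HasOrthogonalPair.of_isometry {v w : Fin 4 → ℤ} (hw : HasOrthogonalPair w)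
    (T : (Fin 4 → ℤ) → Fin 4 → ℤ)
    (hT : ∀ x y, doubleHyperbolic (T x) (T y) = doubleHyperbolic x y) (hv : v = T w) :
    HasOrthogonalPair v := by
  obtain ⟨e, f, x, h⟩ := hw
  exact ⟨T e, T f, T x, by simpa only [hv, hT] using h⟩

/-- Transvections reduce c and d modulo a, and swaps move a nonzero remainder to the first place,
where it is smaller than |a|. The descent ends at a vector in the first plane, orthogonal to the
whole second plane. -/
theorem hasOrthogonalPair_of_ne_zero (n : ℕ) : ∀ a b c d : ℤ, a ≠ 0 → a.natAbs ≤ n →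
    HasOrthogonalPair ![a, b, c, d] := by
  induction n with
  | zero => intro a b c d ha hn; omega
  | succ n ih =>
    intro a b c d ha hn
    have key : HasOrthogonalPair ![a, b + c / a * d, c % a, d] := by
      by_cases hr : c % a = 0
      · rw [hr]
        have key2 : HasOrthogonalPair ![a, b + c / a * d, 0, d % a] := by
          by_cases hr' : d % a = 0
          · rw [hr']
            -- Both remainders vanish: the second plane supplies the pair, the first the negative
            -- vector.
            exact ⟨![0, 0, 1, 0], ![0, 0, 0, 1], ![1, -1, 0, 0], by
              simp [doubleHyperbolic]⟩
          · have h1 := Int.emod_nonneg d ha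
            have h2 := Int.emod_lt_abs d ha
            rw [Int.abs_eq_natAbs] at h2
            refine (ih (d % a) 0 (b + c / a * d) a hr' (by omega)).of_isometry
              (fun x => ![x 3, x 2, x 1, x 0]) ?_ ?_
            · intro x y; simp [doubleHyperbolic]; ring
            · simp
        refine key2.of_isometry (fun x => ![x 0, x 1 - d / a * x 2, x 2, x 3 + d / a * x 0]) ?_ ?_
        · intro x y; simp [doubleHyperbolic]; ring
        · have := Int.emod_add_ediv_mul d a
          simp [this]
      · have h1 := Int.emod_nonneg c ha
        have h2 := Int.emod_lt_abs c ha
        rw [Int.abs_eq_natAbs] at h2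
        refine (ih (c % a) d a (b + c / a * d) hr (by omega)).of_isometry
          (fun x => ![x 2, x 3, x 0, x 1]) ?_ ?_
        · intro x y; simp [doubleHyperbolic]; ring
        · simp
    refine key.of_isometry (fun x => ![x 0, x 1 - c / a * x 3, x 2 + c / a * x 0, x 3]) ?_ ?_
    · intro x y; simp [doubleHyperbolic]; ring
    · have := Int.emod_add_ediv_mul c a
      simp [this]

theorem hasOrthogonalPair (a b c d : ℤ) : HasOrthogonalPair ![a, b, c, d] := by
  by_cases ha : a = 0
  · by_cases hb : b = 0
    · rw [ha, hb]
      exact ⟨![1, 0, 0, 0], ![0, 1, 0, 0], ![0, 0, 1, -1], by simp [doubleHyperbolic]⟩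
    · refine (hasOrthogonalPair_of_ne_zero _ b a c d hb le_rfl).of_isometry
        (fun x => ![x 1, x 0, x 2, x 3]) ?_ ?_
      · intro x y; simp [doubleHyperbolic]; ring
      · simp
  · exact hasOrthogonalPair_of_ne_zero _ a b c d ha le_rfl

end HyperbolicPlanes

/-! ### The E₈ form: positivity, evenness, unimodularity mod 2. -/

section EEight

variable {R : Type} [CommRing R]

theorem pairing_E₈ (x y : Fin 8 → R) : pairing CartanMatrix.E₈ x y =
    x 0 * (2 * y 0 - y 2) + x 1 * (2 * y 1 - y 3) + x 2 * (2 * y 2 - y 0 - y 3) +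
    x 3 * (2 * y 3 - y 1 - y 2 - y 4) + x 4 * (2 * y 4 - y 3 - y 5) +
    x 5 * (2 * y 5 - y 4 - y 6) + x 6 * (2 * y 6 - y 5 - y 7) + x 7 * (2 * y 7 - y 6) := by
  simp [pairing_eq_sum, CartanMatrix.E₈, Fin.sum_univ_eight]
  ring

/-- Squares are completed along the three arms of the Dynkin diagram towards the branch vertex 3,
where 2 - 2/3 - 1/2 - 4/5 = 1/30 remains. -/
theorem pairing_E₈_self_nonneg (x : Fin 8 → ℝ) : 0 ≤ pairing CartanMatrix.E₈ x x ∧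
    (pairing CartanMatrix.E₈ x x = 0 → x = 0) := by
  have h : pairing CartanMatrix.E₈ x x = 2 * (x 0 - x 2 / 2) ^ 2 + 3 / 2 * (x 2 - 2 / 3 * x 3) ^ 2 +
      2 * (x 1 - x 3 / 2) ^ 2 + 2 * (x 7 - x 6 / 2) ^ 2 + 3 / 2 * (x 6 - 2 / 3 * x 5) ^ 2 +
      4 / 3 * (x 5 - 3 / 4 * x 4) ^ 2 + 5 / 4 * (x 4 - 4 / 5 * x 3) ^ 2 + x 3 ^ 2 / 30 := by
    rw [pairing_E₈]; ring
  refine ⟨by rw [h]; positivity, fun h0 => ?_⟩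
  rw [h] at h0
  have p0 := sq_nonneg (x 0 - x 2 / 2)
  have p1 := sq_nonneg (x 2 - 2 / 3 * x 3)
  have p2 := sq_nonneg (x 1 - x 3 / 2)
  have p3 := sq_nonneg (x 7 - x 6 / 2)
  have p4 := sq_nonneg (x 6 - 2 / 3 * x 5)
  have p5 := sq_nonneg (x 5 - 3 / 4 * x 4)
  have p6 := sq_nonneg (x 4 - 4 / 5 * x 3)
  have p7 := sq_nonneg (x 3)
  have h3 : x 3 = 0 := pow_eq_zero_iff two_ne_zero |>.1 (by linarith)
  have h4 : x 4 - 4 / 5 * x 3 = 0 := pow_eq_zero_iff two_ne_zero |>.1 (by linarith)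
  have h5 : x 5 - 3 / 4 * x 4 = 0 := pow_eq_zero_iff two_ne_zero |>.1 (by linarith)
  have h6 : x 6 - 2 / 3 * x 5 = 0 := pow_eq_zero_iff two_ne_zero |>.1 (by linarith)
  have h7 : x 7 - x 6 / 2 = 0 := pow_eq_zero_iff two_ne_zero |>.1 (by linarith)
  have h1 : x 1 - x 3 / 2 = 0 := pow_eq_zero_iff two_ne_zero |>.1 (by linarith)
  have h2 : x 2 - 2 / 3 * x 3 = 0 := pow_eq_zero_iff two_ne_zero |>.1 (by linarith)
  have h0 : x 0 - x 2 / 2 = 0 := pow_eq_zero_iff two_ne_zero |>.1 (by linarith)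
  ext i
  fin_cases i <;> simp only [Pi.zero_apply] <;> simp <;> linarith

theorem even_pairing_E₈_self (x : Fin 8 → ℤ) : Even (pairing CartanMatrix.E₈ x x) := by
  rw [pairing_E₈]
  refine ⟨x 0 ^ 2 + x 1 ^ 2 + x 2 ^ 2 + x 3 ^ 2 + x 4 ^ 2 + x 5 ^ 2 + x 6 ^ 2 + x 7 ^ 2 - x 0 * x 2 -
    x 1 * x 3 - x 2 * x 3 - x 3 * x 4 - x 4 * x 5 - x 5 * x 6 - x 6 * x 7, ?_⟩
  ring

/-- The Cartan matrix has determinant 1, so it is invertible modulo 2. -/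
theorem even_of_even_pairing_E₈ (x : Fin 8 → ℤ) (h : ∀ y, Even (pairing CartanMatrix.E₈ x y)) :
    ∀ i, Even (x i) := by
  have h' : ∀ i, Even (pairing CartanMatrix.E₈ x (Pi.single i 1)) := fun i => h _
  have h0 := h' 0
  have h1 := h' 1
  have h2 := h' 2
  have h3 := h' 3
  have h4 := h' 4
  have h5 := h' 5
  have h6 := h' 6
  have h7 := h' 7
  simp only [Int.even_iff, pairing_E₈, Pi.single_apply] at h0 h1 h2 h3 h4 h5 h6 h7
  simp at h0 h1 h2 h3 h4 h5 h6 h7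
  intro i
  rw [Int.even_iff]
  fin_cases i <;> simp <;> omega

end EEight

/-! ### The vanishing lattice: signature and orthogonal hyperbolic pairs. -/

section Vanishing

variable {R : Type} [CommRing R]

theorem pairing_vanishing (x y : VIdx → R) : pairing vanishingLattice x y =
    2 * (x (.inl 0) * y (.inl 0)) + 2 * (x (.inl 1) * y (.inl 1)) +
    pairing CartanMatrix.E₈ (fun i => x (.inr (.inl (.inl i)))) (fun i => y (.inr (.inl (.inl i)))) +
    pairing CartanMatrix.E₈ (fun i => x (.inr (.inl (.inr i)))) (fun i => y (.inr (.inl (.inr i)))) +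
    (x (.inr (.inr (.inl 0))) * y (.inr (.inr (.inl 1))) +
      x (.inr (.inr (.inl 1))) * y (.inr (.inr (.inl 0)))) +
    (x (.inr (.inr (.inr 0))) * y (.inr (.inr (.inr 1))) +
      x (.inr (.inr (.inr 1))) * y (.inr (.inr (.inr 0)))) := by
  simp only [pairing_eq_sum, vanishingLattice, Fintype.sum_sum_type, Matrix.fromBlocks_apply₁₁,
    Matrix.fromBlocks_apply₁₂, Matrix.fromBlocks_apply₂₁, Matrix.fromBlocks_apply₂₂,
    Matrix.zero_apply, Int.cast_zero, zero_mul, mul_zero, Finset.sum_const_zero, add_zero, zero_add]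
  simp only [hyperbolicPlane, Fin.sum_univ_two]
  simp
  ring

theorem isSymm_E₈ : CartanMatrix.E₈.IsSymm := by
  unfold Matrix.IsSymm
  decide

theorem isSymm_vanishingLattice : vanishingLattice.IsSymm := by
  refine Matrix.IsSymm.fromBlocks (by unfold Matrix.IsSymm; decide) (by simp) ?_
  refine Matrix.IsSymm.fromBlocks ?_ (by simp) ?_
  · exact Matrix.IsSymm.fromBlocks isSymm_E₈ (by simp) isSymm_E₈
  · exact Matrix.IsSymm.fromBlocks (by unfold Matrix.IsSymm; decide) (by simp)
      (by unfold Matrix.IsSymm; decide)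

/-- The two equations cut out a positive definite subspace of codimension 2: each U contributes
twice a square. -/
theorem pairing_vanishing_self_nonneg (x : VIdx → ℝ)
    (h1 : x (.inr (.inr (.inl 0))) = x (.inr (.inr (.inl 1))))
    (h2 : x (.inr (.inr (.inr 0))) = x (.inr (.inr (.inr 1)))) :
    0 ≤ pairing vanishingLattice x x ∧ (pairing vanishingLattice x x = 0 → x = 0) := by
  obtain ⟨p1, q1⟩ := pairing_E₈_self_nonneg (fun i => x (.inr (.inl (.inl i))))
  obtain ⟨p2, q2⟩ := pairing_E₈_self_nonneg (fun i => x (.inr (.inl (.inr i))))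
  have s0 := mul_self_nonneg (x (.inl 0))
  have s1 := mul_self_nonneg (x (.inl 1))
  have s2 := mul_self_nonneg (x (.inr (.inr (.inl 1))))
  have s3 := mul_self_nonneg (x (.inr (.inr (.inr 1))))
  rw [pairing_vanishing, h1, h2]
  refine ⟨by linarith, fun h0 => ?_⟩
  have r1 := q1 (by linarith)
  have r2 := q2 (by linarith)
  have r3 : x (.inl 0) = 0 := mul_self_eq_zero.1 (by linarith)
  have r4 : x (.inl 1) = 0 := mul_self_eq_zero.1 (by linarith)
  have r5 : x (.inr (.inr (.inl 1))) = 0 := mul_self_eq_zero.1 (by linarith)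
  have r6 : x (.inr (.inr (.inr 1))) = 0 := mul_self_eq_zero.1 (by linarith)
  ext i
  rcases i with i | (i | i) | (i | i)
  · fin_cases i
    · exact r3
    · exact r4
  · exact congrFun r1 i
  · exact congrFun r2 i
  · fin_cases i
    · exact h1.trans r5
    · exact r5
  · fin_cases i
    · exact h2.trans r6
    · exact r6

/-- The functionals p, q have positive definite common kernel, so (p, q) is injective on the
negative plane of x, y. If ⟨w, w⟩ ≤ 0, a combination of x, y, w in this kernel would have
nonpositive norm, hence vanish, forcing w = 0. -/
theorem hasIndexTwo_vanishingLattice : HasIndexTwo vanishingLattice := by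
  refine ⟨isSymm_vanishingLattice, ?_⟩
  intro x y w hx hy hxy hwx hwy hw
  let p : (VIdx → ℝ) → ℝ := fun z => z (.inr (.inr (.inl 0))) - z (.inr (.inr (.inl 1)))
  let q : (VIdx → ℝ) → ℝ := fun z => z (.inr (.inr (.inr 0))) - z (.inr (.inr (.inr 1)))
  have hsym := pairing_comm (R := ℝ) vanishingLattice isSymm_vanishingLattice
  have main : ∀ a b c : ℝ, a * p x + b * p y + c * p w = 0 → a * q x + b * q y + c * q w = 0 →
      0 ≤ a ^ 2 * pairing vanishingLattice x x + b ^ 2 * pairing vanishingLattice y y +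
        c ^ 2 * pairing vanishingLattice w w ∧
      (a ^ 2 * pairing vanishingLattice x x + b ^ 2 * pairing vanishingLattice y y +
        c ^ 2 * pairing vanishingLattice w w = 0 → a • x + b • y + c • w = 0) := by
    intro a b c h1 h2
    have := pairing_vanishing_self_nonneg (a • x + b • y + c • w)
      (by simp only [p] at h1
          simp only [Pi.add_apply, Pi.smul_apply, smul_eq_mul]; linarith)
      (by simp only [q] at h2
          simp only [Pi.add_apply, Pi.smul_apply, smul_eq_mul]; linarith)
    have e : pairing vanishingLattice (a • x + b • y + c • w) (a • x + b • y + c • w) =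
        a ^ 2 * pairing vanishingLattice x x + b ^ 2 * pairing vanishingLattice y y +
        c ^ 2 * pairing vanishingLattice w w := by
      simp only [pairing_add_left, pairing_add_right, pairing_smul_left, pairing_smul_right,
        hsym y x, hsym x w, hsym y w, hxy, hwx, hwy]
      ring
    rwa [e] at this
  have main2 : ∀ a b : ℝ, a * p x + b * p y = 0 → a * q x + b * q y = 0 → a = 0 ∧ b = 0 := by
    intro a b h1 h2
    have h3 := (main a b 0 (by linarith) (by linarith)).1
    have h4 : 0 ≤ a ^ 2 * -pairing vanishingLattice x x :=
      mul_nonneg (sq_nonneg a) (by linarith)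
    have h5 : 0 ≤ b ^ 2 * -pairing vanishingLattice y y :=
      mul_nonneg (sq_nonneg b) (by linarith)
    have h6 : a ^ 2 * -pairing vanishingLattice x x = 0 := by linarith
    have h7 : b ^ 2 * -pairing vanishingLattice y y = 0 := by linarith
    constructor
    · exact pow_eq_zero_iff two_ne_zero |>.1 ((mul_eq_zero.1 h6).resolve_right (by linarith))
    · exact pow_eq_zero_iff two_ne_zero |>.1 ((mul_eq_zero.1 h7).resolve_right (by linarith))
  have hD : p x * q y - q x * p y ≠ 0 := by
    intro hD
    obtain ⟨h1, h2⟩ := main2 (p y) (-p x) (by ring) (by linarith)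
    obtain ⟨h3, h4⟩ := main2 (q y) (-q x) (by linarith) (by ring)
    have := (main2 1 0 (by linarith) (by linarith)).1
    norm_num at this
  -- The coefficients are the cross product of the value vectors of p and q on x, y, w.
  obtain ⟨h1, h2⟩ := main (p y * q w - q y * p w) (p w * q x - q w * p x) (p x * q y - q x * p y)
    (by ring) (by ring)
  set a := p y * q w - q y * p w
  set b := p w * q x - q w * p x
  set c := p x * q y - q x * p y
  by_contra hcon
  have hc : 0 < c ^ 2 := by positivity
  have h3 : 0 ≤ a ^ 2 * -pairing vanishingLattice x x := mul_nonneg (sq_nonneg a) (by linarith)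
  have h4 : 0 ≤ b ^ 2 * -pairing vanishingLattice y y := mul_nonneg (sq_nonneg b) (by linarith)
  have h5 : 0 ≤ c ^ 2 * -pairing vanishingLattice w w := mul_nonneg hc.le (by linarith)
  have h6 : a ^ 2 * -pairing vanishingLattice x x = 0 := by linarith
  have h7 : b ^ 2 * -pairing vanishingLattice y y = 0 := by linarith
  have ha : a = 0 := pow_eq_zero_iff two_ne_zero |>.1 ((mul_eq_zero.1 h6).resolve_right (by linarith))
  have hb : b = 0 := pow_eq_zero_iff two_ne_zero |>.1 ((mul_eq_zero.1 h7).resolve_right (by linarith))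
  have h8 := h2 (by linarith)
  rw [ha, hb, zero_smul, zero_smul, zero_add, zero_add] at h8
  exact hw ((smul_eq_zero.1 h8).resolve_left hD)

/-- The inclusion of `U ⊕ U` in the vanishing lattice. -/
def hyperbolicInclusion (x : Fin 4 → ℤ) : VIdx → ℤ :=
  Sum.elim 0 (Sum.elim 0 (Sum.elim ![x 0, x 1] ![x 2, x 3]))

theorem pairing_hyperbolicInclusion (v : VIdx → R) (x : Fin 4 → ℤ) :
    pairing vanishingLattice v (fun i => (hyperbolicInclusion x i : R)) =
      v (.inr (.inr (.inl 0))) * x 1 + v (.inr (.inr (.inl 1))) * x 0 +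
      v (.inr (.inr (.inr 0))) * x 3 + v (.inr (.inr (.inr 1))) * x 2 := by
  rw [pairing_vanishing]
  have h0 : ∀ z : Fin 8 → R, pairing CartanMatrix.E₈ z (fun _ => 0) = 0 := fun z =>
    pairing_zero_right _ z
  simp [hyperbolicInclusion, h0]
  ring

theorem pairing_hyperbolicInclusion_self (x y : Fin 4 → ℤ) :
    pairing vanishingLattice (fun i => (hyperbolicInclusion x i : R))
      (fun i => (hyperbolicInclusion y i : R)) = (doubleHyperbolic x y : R) := by
  rw [pairing_hyperbolicInclusion]
  simp [hyperbolicInclusion, doubleHyperbolic]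

/-- Only the U ⊕ U component of v matters for pairs inside U ⊕ U, and it is integral because U is
unimodular. -/
theorem exists_isTubeFrame (v : dualLattice vanishingLattice)
    (hv : 0 < pairing vanishingLattice (v : VIdx → ℚ) v) : ∃ (e f : VIdx → ℤ) (y : VIdx → ℝ),
      IsTubeFrame vanishingLattice (fun i => ((v : VIdx → ℚ) i : ℝ)) (fun i => (e i : ℝ))
        (fun i => (f i : ℝ)) y := by
  obtain ⟨v, hdual⟩ := v
  have hint : ∀ x : Fin 4 → ℤ, ∃ k : ℤ, v (.inr (.inr (.inl 0))) * x 1 +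
      v (.inr (.inr (.inl 1))) * x 0 + v (.inr (.inr (.inr 0))) * x 3 +
      v (.inr (.inr (.inr 1))) * x 2 = k := by
    intro x
    obtain ⟨k, hk⟩ := hdual (hyperbolicInclusion x)
    exact ⟨k, by rw [← hk, pairing_hyperbolicInclusion]⟩
  obtain ⟨a, ha⟩ := hint ![0, 1, 0, 0]
  obtain ⟨b, hb⟩ := hint ![1, 0, 0, 0]
  obtain ⟨c, hc⟩ := hint ![0, 0, 0, 1]
  obtain ⟨d, hd⟩ := hint ![0, 0, 1, 0]
  simp at ha hb hc hd
  obtain ⟨e, f, x, hee, hff, hef, hxe, hxf, hxx, hve, hvf⟩ := hasOrthogonalPair a b c d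
  have hvx : ∀ x : Fin 4 → ℤ, pairing vanishingLattice (fun i => (v i : ℝ))
      (fun i => (hyperbolicInclusion x i : ℝ)) = (doubleHyperbolic ![a, b, c, d] x : ℝ) := by
    intro x
    rw [pairing_hyperbolicInclusion]
    simp [doubleHyperbolic, ha, hb, hc, hd]
  have hvv : 0 < pairing vanishingLattice (fun i => (v i : ℝ)) (fun i => (v i : ℝ)) := by
    rw [pairing_ratCast_real]
    exact_mod_cast hv
  have hF : IsFrame vanishingLattice (fun i => (v i : ℝ)) (fun i => (hyperbolicInclusion e i : ℝ))
      (fun i => (hyperbolicInclusion f i : ℝ)) :=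
    { vv := hvv.ne'
      ee := by rw [pairing_hyperbolicInclusion_self, hee, Int.cast_zero]
      ff := by rw [pairing_hyperbolicInclusion_self, hff, Int.cast_zero]
      ef := by rw [pairing_hyperbolicInclusion_self, hef, Int.cast_one]
      ve := by rw [hvx, hve, Int.cast_zero]
      vf := by rw [hvx, hvf, Int.cast_zero] }
  have hsym := isSymm_vanishingLattice
  -- The negative vector x need not be orthogonal to v; removing its v-component lowers its norm by
  -- ⟨x, v⟩²/⟨v, v⟩ ≥ 0.
  refine ⟨hyperbolicInclusion e, hyperbolicInclusion f, frameProj vanishingLattice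
    (fun i => (v i : ℝ)) (fun i => (hyperbolicInclusion e i : ℝ))
      (fun i => (hyperbolicInclusion f i : ℝ)) (fun i => (hyperbolicInclusion x i : ℝ)),
    { toIsFrame := hF
      vpos := hvv
      ye := hF.pairing_frameProj_e hsym _
      yf := hF.pairing_frameProj_f _
      yv := hF.pairing_frameProj_v hsym _
      yy := ?_ }⟩
  rw [hF.pairing_frameProj hsym, frameProj, pairing_sub_left, pairing_sub_left, pairing_sub_left,
    pairing_smul_left, pairing_smul_left, pairing_smul_left]
  simp only [pairing_hyperbolicInclusion_self, hxe, hxf, Int.cast_zero, zero_mul, sub_zero]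
  rw [pairing_comm _ hsym (fun i => (hyperbolicInclusion x i : ℝ)) (fun i => (v i : ℝ))]
  have h1 : (doubleHyperbolic x x : ℝ) < 0 := by exact_mod_cast hxx
  set t := pairing vanishingLattice (fun i => (v i : ℝ)) (fun i => (hyperbolicInclusion x i : ℝ))
  set s := pairing vanishingLattice (fun i => (v i : ℝ)) (fun i => (v i : ℝ))
  have h2 : 0 ≤ t / s * t := by
    rw [div_mul_eq_mul_div]
    exact div_nonneg (mul_self_nonneg t) hvv.le
  linarith

end Vanishing

/-! ### Halves of lattice vectors and their discriminant classes. -/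

section Parity

/-- This lets a norm modulo 8 count the odd A₁ coordinates. -/
theorem mul_self_emod_four (n : ℤ) : n * n % 4 = n % 2 := by
  rcases Int.emod_two_eq_zero_or_one n with h | h
  · obtain ⟨k, rfl⟩ := Int.even_iff.2 h
    ring_nf
    omega
  · obtain ⟨k, rfl⟩ := Int.odd_iff.2 h
    ring_nf
    omega

/-- Outside A₁² the lattice is unimodular, so even products force even coordinates. -/
theorem even_coordinates {x : VIdx → ℤ} (h : ∀ m, Even (pairing vanishingLattice x m))
    (i : (Fin 8 ⊕ Fin 8) ⊕ (Fin 2 ⊕ Fin 2)) : Even (x (.inr i)) := by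
  have h0 : ∀ z : Fin 8 → ℤ, pairing CartanMatrix.E₈ z (fun _ => 0) = 0 := fun z =>
    pairing_zero_right _ z
  have hU : ∀ y : Fin 4 → ℤ, Even (x (.inr (.inr (.inl 0))) * y 1 +
      x (.inr (.inr (.inl 1))) * y 0 + x (.inr (.inr (.inr 0))) * y 3 +
      x (.inr (.inr (.inr 1))) * y 2) := fun y => by
    have := h (hyperbolicInclusion y)
    rwa [← show _ = pairing vanishingLattice x (hyperbolicInclusion y) from
      (pairing_hyperbolicInclusion x y).symm] at this
  rcases i with (i | i) | (i | i)
  · refine even_of_even_pairing_E₈ (fun i => x (.inr (.inl (.inl i)))) (fun y => ?_) i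
    have := h (Sum.elim 0 (Sum.elim (Sum.elim y 0) 0))
    rw [pairing_vanishing] at this
    simpa [h0] using this
  · refine even_of_even_pairing_E₈ (fun i => x (.inr (.inl (.inr i)))) (fun y => ?_) i
    have := h (Sum.elim 0 (Sum.elim (Sum.elim 0 y) 0))
    rw [pairing_vanishing] at this
    simpa [h0] using this
  · fin_cases i
    · simpa using hU ![0, 1, 0, 0]
    · simpa using hU ![1, 0, 0, 0]
  · fin_cases i
    · simpa using hU ![0, 0, 0, 1]
    · simpa using hU ![0, 0, 1, 0]

/-- The remaining coordinates are twice integers, so E₈ contributes 4 times an even number and U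
contributes 2 · 2 · 2 times an integer. -/
theorem exists_norm_eq {x : VIdx → ℤ} (h : ∀ m, Even (pairing vanishingLattice x m)) :
    ∃ k, pairing vanishingLattice x x =
      2 * (x (.inl 0) * x (.inl 0)) + 2 * (x (.inl 1) * x (.inl 1)) + 8 * k := by
  choose t ht using even_coordinates h
  obtain ⟨p, hp⟩ := even_pairing_E₈_self fun i => t (.inl (.inl i))
  obtain ⟨q, hq⟩ := even_pairing_E₈_self fun i => t (.inl (.inr i))
  refine ⟨p + q + t (.inr (.inl 0)) * t (.inr (.inl 1)) + t (.inr (.inr 0)) * t (.inr (.inr 1)), ?_⟩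
  have e1 : (fun i => x (.inr (.inl (.inl i)))) = (2 : ℤ) • fun i => t (.inl (.inl i)) := by
    ext i; simp [ht]; ring
  have e2 : (fun i => x (.inr (.inl (.inr i)))) = (2 : ℤ) • fun i => t (.inl (.inr i)) := by
    ext i; simp [ht]; ring
  rw [pairing_vanishing, e1, e2]
  simp only [pairing_smul_left, pairing_smul_right, hp, hq, ht]
  ring

/-- Half of a vector of the vanishing lattice. -/
def halfVector (x : VIdx → ℤ) : VIdx → ℚ := fun i => (x i : ℚ) / 2

theorem halfVector_eq_smul (x : VIdx → ℤ) :
    halfVector x = (1 / 2 : ℚ) • fun i => (x i : ℚ) := by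
  ext i
  simp [halfVector]
  ring

theorem halfVector_mem {x : VIdx → ℤ} (h : ∀ m, Even (pairing vanishingLattice x m)) :
    halfVector x ∈ dualLattice vanishingLattice := by
  intro m
  obtain ⟨k, hk⟩ := h m
  refine ⟨k, ?_⟩
  rw [halfVector_eq_smul, pairing_smul_left, pairing_intCast, hk]
  push_cast
  ring

/-- Here y records the parities of the A₁ coordinates, so that x - y is in 2Λ_GM. -/
theorem discriminantClass_halfVector {x y : VIdx → ℤ}
    (h : ∀ m, Even (pairing vanishingLattice x m)) (h0 : Even (x (.inl 0) - y (.inl 0)))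
    (h1 : Even (x (.inl 1) - y (.inl 1))) (h2 : ∀ i, y (.inr i) = 0)
    {w : dualLattice vanishingLattice} (hw : ∀ i, (w : VIdx → ℚ) i = (y i : ℚ) / 2) :
    discriminantClass vanishingLattice ⟨halfVector x, halfVector_mem h⟩ =
      discriminantClass vanishingLattice w := by
  have hev : ∀ i, Even (x i - y i) := by
    rintro (i | i)
    · fin_cases i
      · exact h0
      · exact h1
    · rw [h2, sub_zero]; exact even_coordinates h i
  choose t ht using hev
  refine (QuotientAddGroup.eq_iff_sub_mem).2 ?_
  rw [AddSubgroup.mem_addSubgroupOf]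
  refine ⟨t, funext fun i => ?_⟩
  change halfVector x i - (w : VIdx → ℚ) i = t i
  have : (x i : ℚ) - y i = t i + t i := by exact_mod_cast ht i
  rw [hw, halfVector]
  linarith

end Parity

/-! ### Labellings, their projections to Λ_GM, and the conclusion. -/

section Marking

variable {h₁ h₂ : HIdx → ℤ} {j : (VIdx → ℤ) →ₗ[ℤ] (HIdx → ℤ)}

theorem isSymm_middleLattice : middleLattice.IsSymm := Matrix.isSymm_diagonal _

theorem pairing_middle_comm {R : Type} [CommRing R] (x y : HIdx → R) :
    pairing middleLattice x y = pairing middleLattice y x :=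
  pairing_comm _ isSymm_middleLattice x y

theorem IsMarking.gram_eq (hj : IsMarking h₁ h₂ j) : pairing middleLattice h₁ h₁ = 2 ∧
    pairing middleLattice h₁ h₂ = 0 ∧ pairing middleLattice h₂ h₂ = 2 := by
  have h00 := congrFun (congrFun hj.1 0) 0
  have h01 := congrFun (congrFun hj.1 0) 1
  have h11 := congrFun (congrFun hj.1 1) 1
  simp [gram] at h00 h01 h11
  exact ⟨by exact_mod_cast h00, by exact_mod_cast h01, by exact_mod_cast h11⟩

theorem IsMarking.orthogonal (hj : IsMarking h₁ h₂ j) (x : VIdx → ℤ) :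
    pairing middleLattice h₁ (j x) = 0 ∧ pairing middleLattice h₂ (j x) = 0 :=
  (hj.2.2 (j x)).1 ⟨x, rfl⟩

/-- `x` is twice the orthogonal projection of `ζ` to the vanishing lattice, where `a, b` are the
products of `ζ` with `h₁, h₂`. -/
structure IsDoubleProjection (h₁ h₂ : HIdx → ℤ) (j : (VIdx → ℤ) →ₗ[ℤ] (HIdx → ℤ)) (a b : ℤ)
    (ζ : HIdx → ℤ) (x : VIdx → ℤ) : Prop where
  left : pairing middleLattice h₁ ζ = a
  right : pairing middleLattice h₂ ζ = b
  map : j x = (2 : ℤ) • ζ - a • h₁ - b • h₂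

theorem IsMarking.exists_doubleProjection (hj : IsMarking h₁ h₂ j) {a b : ℤ} {ζ : HIdx → ℤ}
    (ha : pairing middleLattice h₁ ζ = a) (hb : pairing middleLattice h₂ ζ = b) :
    ∃ x, IsDoubleProjection h₁ h₂ j a b ζ x := by
  obtain ⟨h11, h12, h22⟩ := hj.gram_eq
  obtain ⟨x, hx⟩ := (hj.2.2 ((2 : ℤ) • ζ - a • h₁ - b • h₂)).2 (by
    simp only [pairing_sub_right, pairing_smul_right, ha, hb, h11, h12, h22,
      pairing_middle_comm h₂ h₁]
    constructor <;> ring)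
  exact ⟨x, ha, hb, hx⟩

section

variable (hj : IsMarking h₁ h₂ j) {a b : ℤ} {ζ : HIdx → ℤ} {x : VIdx → ℤ}
  (hx : IsDoubleProjection h₁ h₂ j a b ζ x)
include hj hx

theorem IsDoubleProjection.pairing_eq (m : VIdx → ℤ) :
    pairing vanishingLattice x m = 2 * pairing middleLattice ζ (j m) := by
  obtain ⟨h1, h2⟩ := hj.orthogonal m
  rw [← hj.2.1, hx.map]
  simp only [pairing_sub_left, pairing_smul_left, h1, h2]
  ring

theorem IsDoubleProjection.even_pairing (m : VIdx → ℤ) : Even (pairing vanishingLattice x m) := by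
  rw [hx.pairing_eq hj]
  exact even_two_mul _

theorem IsDoubleProjection.norm_eq :
    pairing vanishingLattice x x = 4 * pairing middleLattice ζ ζ - 2 * a ^ 2 - 2 * b ^ 2 := by
  rw [hx.pairing_eq hj, hx.map]
  simp only [pairing_sub_right, pairing_smul_right, pairing_middle_comm ζ h₁,
    pairing_middle_comm ζ h₂, hx.left, hx.right]
  ring

theorem IsDoubleProjection.coordinate_eq (i : Fin 2) :
    x (.inl i) = pairing middleLattice ζ (j (Pi.single (.inl i) 1)) := by
  have h0 : ∀ z : Fin 8 → ℤ, pairing CartanMatrix.E₈ z (fun _ => 0) = 0 := fun z =>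
    pairing_zero_right _ z
  have h1 : pairing vanishingLattice x (Pi.single (.inl i) 1) = 2 * x (.inl i) := by
    rw [pairing_vanishing]
    fin_cases i <;> simp [h0]
  have := hx.pairing_eq hj (Pi.single (.inl i) 1)
  linarith

theorem IsDoubleProjection.exists_parity : ∃ k, 4 * pairing middleLattice ζ ζ - 2 * a ^ 2 - 2 * b ^ 2 =
    2 * (x (.inl 0) * x (.inl 0)) + 2 * (x (.inl 1) * x (.inl 1)) + 8 * k := by
  rw [← hx.norm_eq hj]
  exact exists_norm_eq (hx.even_pairing hj)

/-- Vectors with the same products with `h₁, h₂` have congruent projections. -/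
theorem IsDoubleProjection.coordinate_congr {ζ' : HIdx → ℤ} {x' : VIdx → ℤ}
    (hx' : IsDoubleProjection h₁ h₂ j a b ζ' x') : x (.inl 0) % 2 = x' (.inl 0) % 2 := by
  obtain ⟨t, ht⟩ := (hj.2.2 (ζ - ζ')).2 (by
    simp only [pairing_sub_right, hx.left, hx.right, hx'.left, hx'.right, sub_self, and_self])
  have h0 : ∀ z : Fin 8 → ℤ, pairing CartanMatrix.E₈ z (fun _ => 0) = 0 := fun z =>
    pairing_zero_right _ z
  have h1 : pairing vanishingLattice t (Pi.single (.inl 0) 1) = 2 * t (.inl 0) := by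
    rw [pairing_vanishing]
    simp [h0]
  have h2 : x (.inl 0) - x' (.inl 0) = 2 * t (.inl 0) := by
    rw [hx.coordinate_eq hj, hx'.coordinate_eq hj, ← h1, ← hj.2.1, ht, pairing_sub_left]
  omega

end

/-- The projections of vectors with products `1, 0` and `0, 1` are not congruent. -/
theorem IsMarking.coordinate_not_congr (hj : IsMarking h₁ h₂ j) {ζ ζ' : HIdx → ℤ}
    {x x' : VIdx → ℤ} (hx : IsDoubleProjection h₁ h₂ j 1 0 ζ x)
    (hx' : IsDoubleProjection h₁ h₂ j 0 1 ζ' x') : x (.inl 0) % 2 ≠ x' (.inl 0) % 2 := by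
  intro h0
  obtain ⟨k, hk⟩ := hx.exists_parity hj
  obtain ⟨k', hk'⟩ := hx'.exists_parity hj
  have m0 := mul_self_emod_four (x (.inl 0))
  have m1 := mul_self_emod_four (x (.inl 1))
  have m0' := mul_self_emod_four (x' (.inl 0))
  have m1' := mul_self_emod_four (x' (.inl 1))
  -- Both norms are ≡ 2 mod 4, so exactly one A₁ coordinate of each vector is odd.
  have h1 : x (.inl 1) % 2 = x' (.inl 1) % 2 := by omega
  have hev : ∀ i, ∃ t, x i - x' i = 2 * t := by
    rintro (i | i)
    · fin_cases i
      · exact ⟨(x (.inl 0) - x' (.inl 0)) / 2, by simp; omega⟩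
      · exact ⟨(x (.inl 1) - x' (.inl 1)) / 2, by simp; omega⟩
    · obtain ⟨s, hs⟩ := even_coordinates (hx.even_pairing hj) i
      obtain ⟨s', hs'⟩ := even_coordinates (hx'.even_pairing hj) i
      exact ⟨s - s', by rw [hs, hs']; ring⟩
  choose t ht using hev
  have e1 : x - x' = (2 : ℤ) • t := by ext i; simpa using ht i
  -- Pairing x - x' = 2t with ζ gives an odd number on one side, from the term -⟨h₁, ζ⟩ = -1, and an
  -- even one on the other.
  have e2 := congrArg (fun y => pairing middleLattice (j y) ζ) e1
  simp only [map_sub, map_smul, hx.map, hx'.map, pairing_sub_left, pairing_smul_left, hx.left,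
    hx.right] at e2
  omega

/-- The parity r of the first coordinate is common to all ζ of type (1, 0), and type (0, 1) has the
opposite one. Since r depends only on the marking, so does the renaming of the two generators. -/
theorem IsMarking.exists_swap (hj : IsMarking h₁ h₂ j) : ∃ r : ℤ, (r = 0 ∨ r = 1) ∧
    (∀ ζ x, IsDoubleProjection h₁ h₂ j 1 0 ζ x → x (.inl 0) % 2 = r) ∧
    (∀ ζ x, IsDoubleProjection h₁ h₂ j 0 1 ζ x → x (.inl 0) % 2 = 1 - r) := by
  by_cases h : ∃ ζ x, IsDoubleProjection h₁ h₂ j 1 0 ζ x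
  · obtain ⟨ζ₀, x₀, h₀⟩ := h
    refine ⟨x₀ (.inl 0) % 2, by omega, fun ζ x hx => hx.coordinate_congr hj h₀, fun ζ x hx => ?_⟩
    have := hj.coordinate_not_congr h₀ hx
    omega
  by_cases h' : ∃ ζ x, IsDoubleProjection h₁ h₂ j 0 1 ζ x
  · obtain ⟨ζ₀, x₀, h₀⟩ := h'
    refine ⟨1 - x₀ (.inl 0) % 2, by omega, fun ζ x hx => absurd ⟨ζ, x, hx⟩ h, fun ζ x hx => ?_⟩
    have := hx.coordinate_congr hj h₀
    omega
  -- Neither type occurs, so any value of r will do.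
  · exact ⟨0, by simp, fun ζ x hx => absurd ⟨ζ, x, hx⟩ h, fun ζ x hx => absurd ⟨ζ, x, hx⟩ h'⟩

theorem pairing_complexify (z : VIdx → ℂ) (k : HIdx → ℤ) :
    pairing middleLattice (complexify j z) (fun i => (k i : ℂ)) =
      ∑ l, z l * ((pairing middleLattice (j (Pi.single l 1)) k : ℤ) : ℂ) := by
  have h : complexify j z = ∑ l, z l • fun i => ((j (Pi.single l 1) i : ℤ) : ℂ) := by
    ext i
    simp only [complexify, Matrix.mulVec, dotProduct, Matrix.map_apply, LinearMap.toMatrix'_apply,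
      Finset.sum_apply, Pi.smul_apply, smul_eq_mul]
    refine Finset.sum_congr rfl fun l _ => ?_
    rw [mul_comm]
  have hs : ∀ (s : Finset VIdx) (g : VIdx → HIdx → ℂ) (y : HIdx → ℂ),
      pairing middleLattice (∑ l ∈ s, g l) y = ∑ l ∈ s, pairing middleLattice (g l) y := by
    intro s g y
    induction s using Finset.induction_on with
    | empty => simp [pairing_zero_left]
    | insert a s ha ih => rw [Finset.sum_insert ha, Finset.sum_insert ha, pairing_add_left, ih]
  rw [h, hs]
  refine Finset.sum_congr rfl fun l _ => ?_
  rw [pairing_smul_left, pairing_intCast]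

theorem pairing_intCast_right {ι : Type} [Fintype ι] [DecidableEq ι] (G : Matrix ι ι ℤ) (z : ι → ℂ)
    (x : ι → ℤ) : pairing G z (fun i => (x i : ℂ)) =
      ∑ l, z l * ((pairing G (Pi.single l 1) x : ℤ) : ℂ) := by
  rw [pairing, dotProduct]
  refine Finset.sum_congr rfl fun l _ => ?_
  rw [pairing_int, single_one_dotProduct]
  simp [Matrix.mulVec, dotProduct]

theorem IsMarking.pairing_complexify (hj : IsMarking h₁ h₂ j) (z : VIdx → ℂ) (x : VIdx → ℤ) :
    pairing middleLattice (complexify j z) (fun i => (j x i : ℂ)) =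
      pairing vanishingLattice z (fun i => (x i : ℂ)) := by
  rw [GushelMukai.pairing_complexify, pairing_intCast_right]
  simp only [hj.2.1]

/-- Periods are already orthogonal to h₁ and h₂, so orthogonality to K is the single condition from
ζ, equivalently from its projection. -/
theorem IsDoubleProjection.orthogonalSection_eq (hj : IsMarking h₁ h₂ j) {a b : ℤ} {ζ : HIdx → ℤ}
    {x : VIdx → ℤ} (hx : IsDoubleProjection h₁ h₂ j a b ζ x) :
    orthogonalSection j (Submodule.span ℤ {h₁, h₂, ζ}) =
      hyperplaneSection vanishingLattice (halfVector x) := by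
  ext w
  set z := (w : ℙ ℂ (VIdx → ℂ)).rep
  set Z := complexify j z
  have hz1 : pairing middleLattice Z (fun i => (h₁ i : ℂ)) = 0 := by
    simp only [Z, GushelMukai.pairing_complexify, pairing_middle_comm _ h₁, (hj.orthogonal _).1]
    simp
  have hz2 : pairing middleLattice Z (fun i => (h₂ i : ℂ)) = 0 := by
    simp only [Z, GushelMukai.pairing_complexify, pairing_middle_comm _ h₂, (hj.orthogonal _).2]
    simp
  have hlin : ∀ (p q r : ℤ), pairing middleLattice Z (fun i => ((p • h₁ + q • h₂ + r • ζ) i : ℂ)) =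
      r * pairing middleLattice Z (fun i => (ζ i : ℂ)) := by
    intro p q r
    have : (fun i => (((p • h₁ + q • h₂ + r • ζ) i : ℤ) : ℂ)) = (p : ℂ) • (fun i => (h₁ i : ℂ)) +
        (q : ℂ) • (fun i => (h₂ i : ℂ)) + (r : ℂ) • (fun i => (ζ i : ℂ)) := by
      ext i; simp
    rw [this, pairing_add_right, pairing_add_right, pairing_smul_right, pairing_smul_right,
      pairing_smul_right, hz1, hz2]
    ring
  have hv : pairing vanishingLattice (fun i => ((halfVector x i : ℚ) : ℂ)) z =
      pairing middleLattice Z (fun i => (ζ i : ℂ)) := by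
    have e1 : (fun i => ((halfVector x i : ℚ) : ℂ)) = (1 / 2 : ℂ) • fun i => (x i : ℂ) := by
      ext i
      simp [halfVector]
      ring
    have e2 : j x = (-a) • h₁ + (-b) • h₂ + (2 : ℤ) • ζ := by
      rw [hx.map]
      simp only [neg_smul]
      abel
    rw [e1, pairing_smul_left, pairing_comm _ isSymm_vanishingLattice, ← hj.pairing_complexify, e2,
      hlin]
    push_cast
    ring
  change (∀ k ∈ Submodule.span ℤ {h₁, h₂, ζ}, pairing middleLattice Z (fun i => (k i : ℂ)) = 0) ↔
    pairing vanishingLattice (fun i => ((halfVector x i : ℚ) : ℂ)) z = 0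
  rw [hv]
  constructor
  · intro h
    exact h ζ (Submodule.subset_span (by simp))
  · intro h k hk
    obtain ⟨p, q, r, rfl⟩ := Submodule.mem_span_triple.1 hk
    rw [hlin, h, mul_zero]

theorem IsDoubleProjection.isHeegnerComponent (hj : IsMarking h₁ h₂ j) {a b : ℤ} {ζ : HIdx → ℤ}
    {x : VIdx → ℤ} (hx : IsDoubleProjection h₁ h₂ j a b ζ x) {d : ℕ} (hd : 0 < d)
    (hn : 4 * pairing middleLattice ζ ζ - 2 * a ^ 2 - 2 * b ^ 2 = d) :
    IsHeegnerComponent j (Submodule.span ℤ {h₁, h₂, ζ}) ((d : ℚ) / 8)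
      (discriminantClass vanishingLattice ⟨halfVector x, halfVector_mem (hx.even_pairing hj)⟩) := by
  have hnorm : pairing vanishingLattice (halfVector x) (halfVector x) = (d : ℚ) / 4 := by
    rw [halfVector_eq_smul, pairing_smul_left, pairing_smul_right, pairing_intCast, hx.norm_eq hj, hn]
    push_cast
    ring
  have hd' : (0 : ℚ) < d := by exact_mod_cast hd
  obtain ⟨e, f, y, hF⟩ := exists_isTubeFrame
    ⟨halfVector x, halfVector_mem (hx.even_pairing hj)⟩ (by rw [hnorm]; positivity)
  rw [IsHeegnerComponent, periodDivisor, hx.orthogonalSection_eq hj]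
  exact hF.isComponent hasIndexTwo_vanishingLattice (by rw [hnorm]; ring)

theorem IsLabellingWithGram.exists_doubleProjection (hj : IsMarking h₁ h₂ j)
    {Q : Matrix (Fin 3) (Fin 3) ℚ} {K : Submodule ℤ (HIdx → ℤ)}
    (hK : IsLabellingWithGram h₁ h₂ Q K) {a b : ℤ} (ha : Q 0 2 = a) (hb : Q 1 2 = b) :
    ∃ ζ x, K = Submodule.span ℤ {h₁, h₂, ζ} ∧ IsDoubleProjection h₁ h₂ j a b ζ x ∧
      ((pairing middleLattice ζ ζ : ℤ) : ℚ) = Q 2 2 := by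
  obtain ⟨-, ζ, hKs, hg⟩ := hK
  have g02 := congrFun (congrFun hg 0) 2
  have g12 := congrFun (congrFun hg 1) 2
  have g22 := congrFun (congrFun hg 2) 2
  rw [ha] at g02
  rw [hb] at g12
  simp [gram] at g02 g12 g22
  obtain ⟨x, hx⟩ := hj.exists_doubleProjection (a := a) (b := b) (ζ := ζ)
    (by exact_mod_cast g02) (by exact_mod_cast g12)
  exact ⟨ζ, x, hKs, hx, g22⟩

/-- The period divisors attached to the labellings are components of Heegner divisors. -/
theorem IsMarking.isHeegnerComponent_of_isLabellingWithGram
    (h₁ h₂ : HIdx → ℤ)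
    (j : (VIdx → ℤ) →ₗ[ℤ] (HIdx → ℤ))
    (hj : IsMarking h₁ h₂ j) :
    ∃ e f : dualLattice vanishingLattice,
      ((e = eStar ∧ f = fStar) ∨
        (e = fStar ∧ f = eStar)) ∧
      ∀ d : ℕ, 0 < d →
        (d ≡ 0 [MOD 8] → ∀ K : Submodule ℤ (HIdx → ℤ),
          IsLabellingWithGram h₁ h₂
            !![2, 0, 0; 0, 2, 0; 0, 0, (d : ℚ) / 4] K →
          IsHeegnerComponent j K ((d : ℚ) / 8) 0) ∧
        (d ≡ 2 [MOD 8] → ∀ K' : Submodule ℤ (HIdx → ℤ),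
          IsLabellingWithGram h₁ h₂
            !![2, 0, 1; 0, 2, 0; 1, 0, ((d : ℚ) + 2) / 4] K' →
          IsHeegnerComponent j K' ((d : ℚ) / 8)
            (discriminantClass vanishingLattice e)) ∧
        (d ≡ 2 [MOD 8] → ∀ K'' : Submodule ℤ (HIdx → ℤ),
          IsLabellingWithGram h₁ h₂
            !![2, 0, 0; 0, 2, 1; 0, 1, ((d : ℚ) + 2) / 4] K'' →
          IsHeegnerComponent j K'' ((d : ℚ) / 8)
            (discriminantClass vanishingLattice f)) ∧
        (d ≡ 4 [MOD 8] → ∀ K : Submodule ℤ (HIdx → ℤ),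
          IsLabellingWithGram h₁ h₂
            !![2, 0, 1; 0, 2, 1; 1, 1, ((d : ℚ) + 4) / 4] K →
          IsHeegnerComponent j K ((d : ℚ) / 8)
            (discriminantClass vanishingLattice
              (eStar + fStar))) := by
  have heStar : ∀ i, (eStar : VIdx → ℚ) i = ((Pi.single (.inl 0) 1 : VIdx → ℤ) i : ℚ) / 2 := by
    intro i
    rcases eq_or_ne i (.inl 0) with rfl | hi
    · simp [eStar, halfGenerator]
    · simp [eStar, halfGenerator, hi]
  have hfStar : ∀ i, (fStar : VIdx → ℚ) i = ((Pi.single (.inl 1) 1 : VIdx → ℤ) i : ℚ) / 2 := by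
    intro i
    rcases eq_or_ne i (.inl 1) with rfl | hi
    · simp [fStar, halfGenerator]
    · simp [fStar, halfGenerator, hi]
  obtain ⟨r, hr, hr1, hr2⟩ := hj.exists_swap
  have hodd : ∀ {a b : ℤ} {ζ : HIdx → ℤ} {x : VIdx → ℤ} (hx : IsDoubleProjection h₁ h₂ j a b ζ x)
      {d : ℕ}, d ≡ 2 [MOD 8] → 4 * pairing middleLattice ζ ζ - 2 * a ^ 2 - 2 * b ^ 2 = d →
      (x (.inl 0) % 2 = 1 → discriminantClass vanishingLattice
        ⟨halfVector x, halfVector_mem (hx.even_pairing hj)⟩ =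
          discriminantClass vanishingLattice eStar) ∧
      (x (.inl 0) % 2 = 0 → discriminantClass vanishingLattice
        ⟨halfVector x, halfVector_mem (hx.even_pairing hj)⟩ =
          discriminantClass vanishingLattice fStar) := by
    intro a b ζ x hx d hd hn
    obtain ⟨k, hk⟩ := hx.exists_parity hj
    have m0 := mul_self_emod_four (x (.inl 0))
    have m1 := mul_self_emod_four (x (.inl 1))
    have hd' : d % 8 = 2 := hd
    rw [hn] at hk
    constructor
    · intro h0
      refine discriminantClass_halfVector (y := Pi.single (.inl 0) 1) (hx.even_pairing hj) ?_ ?_ (by simp) heStar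
      · rw [Int.even_iff]; simp; omega
      · rw [Int.even_iff]; simp; omega
    · intro h0
      refine discriminantClass_halfVector (y := Pi.single (.inl 1) 1) (hx.even_pairing hj) ?_ ?_ (by simp) hfStar
      · rw [Int.even_iff]; simp; omega
      · rw [Int.even_iff]; simp; omega
  -- When r = 1, type (1, 0) has its odd coordinate first, which is the class of `eStar`.
  refine ⟨if r = 1 then eStar else fStar, if r = 1 then fStar else eStar, ?_, ?_⟩
  · rcases hr with rfl | rfl <;> simp
  intro d hd
  refine ⟨fun hd8 K hK => ?_, fun hd8 K hK => ?_, fun hd8 K hK => ?_, fun hd8 K hK => ?_⟩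
  · obtain ⟨ζ, x, rfl, hx, hg⟩ := hK.exists_doubleProjection hj (a := 0) (b := 0) (by simp) (by simp)
    have hn : 4 * pairing middleLattice ζ ζ - 2 * 0 ^ 2 - 2 * 0 ^ 2 = (d : ℤ) := by
      simp at hg
      have : 4 * ((pairing middleLattice ζ ζ : ℤ) : ℚ) = d := by rw [hg]; ring
      have : 4 * pairing middleLattice ζ ζ = d := by exact_mod_cast this
      linarith
    have hc := hx.isHeegnerComponent hj hd hn
    obtain ⟨k, hk⟩ := hx.exists_parity hj
    have m0 := mul_self_emod_four (x (.inl 0))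
    have m1 := mul_self_emod_four (x (.inl 1))
    have hd' : d % 8 = 0 := hd8
    rw [hn] at hk
    rwa [discriminantClass_halfVector (y := 0) (w := 0) (hx.even_pairing hj) (by rw [Int.even_iff]; simp; omega)
      (by rw [Int.even_iff]; simp; omega) (by simp) (by simp)] at hc
  · obtain ⟨ζ, x, rfl, hx, hg⟩ := hK.exists_doubleProjection hj (a := 1) (b := 0) (by simp) (by simp)
    have hn : 4 * pairing middleLattice ζ ζ - 2 * 1 ^ 2 - 2 * 0 ^ 2 = (d : ℤ) := by
      simp at hg
      have : 4 * ((pairing middleLattice ζ ζ : ℤ) : ℚ) = d + 2 := by rw [hg]; ring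
      have : 4 * pairing middleLattice ζ ζ = d + 2 := by exact_mod_cast this
      linarith
    have hc := hx.isHeegnerComponent hj hd hn
    have hrx := hr1 ζ x hx
    rcases hr with rfl | rfl
    · rwa [(hodd hx hd8 hn).2 hrx] at hc
    · rwa [(hodd hx hd8 hn).1 hrx] at hc
  · obtain ⟨ζ, x, rfl, hx, hg⟩ := hK.exists_doubleProjection hj (a := 0) (b := 1) (by simp) (by simp)
    have hn : 4 * pairing middleLattice ζ ζ - 2 * 0 ^ 2 - 2 * 1 ^ 2 = (d : ℤ) := by
      simp at hg
      have : 4 * ((pairing middleLattice ζ ζ : ℤ) : ℚ) = d + 2 := by rw [hg]; ring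
      have : 4 * pairing middleLattice ζ ζ = d + 2 := by exact_mod_cast this
      linarith
    have hc := hx.isHeegnerComponent hj hd hn
    have hrx := hr2 ζ x hx
    rcases hr with rfl | rfl
    · rwa [(hodd hx hd8 hn).1 hrx] at hc
    · rwa [(hodd hx hd8 hn).2 hrx] at hc
  · obtain ⟨ζ, x, rfl, hx, hg⟩ := hK.exists_doubleProjection hj (a := 1) (b := 1) (by simp) (by simp)
    have hn : 4 * pairing middleLattice ζ ζ - 2 * 1 ^ 2 - 2 * 1 ^ 2 = (d : ℤ) := by
      simp at hg
      have : 4 * ((pairing middleLattice ζ ζ : ℤ) : ℚ) = d + 4 := by rw [hg]; ring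
      have : 4 * pairing middleLattice ζ ζ = d + 4 := by exact_mod_cast this
      linarith
    have hc := hx.isHeegnerComponent hj hd hn
    obtain ⟨k, hk⟩ := hx.exists_parity hj
    have m0 := mul_self_emod_four (x (.inl 0))
    have m1 := mul_self_emod_four (x (.inl 1))
    have hd' : d % 8 = 4 := hd8
    rw [hn] at hk
    rwa [discriminantClass_halfVector (y := Pi.single (.inl 0) 1 + Pi.single (.inl 1) 1)
      (w := eStar + fStar) (hx.even_pairing hj) (by rw [Int.even_iff]; simp; omega)
      (by rw [Int.even_iff]; simp; omega) (by simp) (fun i => by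
        rw [AddSubgroup.coe_add, Pi.add_apply, heStar, hfStar, Pi.add_apply]
        push_cast
        ring)] at hc

end Marking

end GushelMukai

end

theorem mainTheorem8
    (h₁ h₂ : GushelMukai.HIdx → ℤ)
    (j : (GushelMukai.VIdx → ℤ) →ₗ[ℤ] (GushelMukai.HIdx → ℤ))
    (hj : GushelMukai.IsMarking h₁ h₂ j) :
    ∃ e f : GushelMukai.dualLattice GushelMukai.vanishingLattice,
      ((e = GushelMukai.eStar ∧ f = GushelMukai.fStar) ∨
        (e = GushelMukai.fStar ∧ f = GushelMukai.eStar)) ∧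
      ∀ d : ℕ, 0 < d →
        (d ≡ 0 [MOD 8] → ∀ K : Submodule ℤ (GushelMukai.HIdx → ℤ),
          GushelMukai.IsLabellingWithGram h₁ h₂
            !![2, 0, 0; 0, 2, 0; 0, 0, (d : ℚ) / 4] K →
          GushelMukai.IsHeegnerComponent j K ((d : ℚ) / 8) 0) ∧
        (d ≡ 2 [MOD 8] → ∀ K' : Submodule ℤ (GushelMukai.HIdx → ℤ),
          GushelMukai.IsLabellingWithGram h₁ h₂
            !![2, 0, 1; 0, 2, 0; 1, 0, ((d : ℚ) + 2) / 4] K' →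
          GushelMukai.IsHeegnerComponent j K' ((d : ℚ) / 8)
            (GushelMukai.discriminantClass GushelMukai.vanishingLattice e)) ∧
        (d ≡ 2 [MOD 8] → ∀ K'' : Submodule ℤ (GushelMukai.HIdx → ℤ),
          GushelMukai.IsLabellingWithGram h₁ h₂
            !![2, 0, 0; 0, 2, 1; 0, 1, ((d : ℚ) + 2) / 4] K'' →
          GushelMukai.IsHeegnerComponent j K'' ((d : ℚ) / 8)
            (GushelMukai.discriminantClass GushelMukai.vanishingLattice f)) ∧
        (d ≡ 4 [MOD 8] → ∀ K : Submodule ℤ (GushelMukai.HIdx → ℤ),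
          GushelMukai.IsLabellingWithGram h₁ h₂
            !![2, 0, 1; 0, 2, 1; 1, 1, ((d : ℚ) + 4) / 4] K →
          GushelMukai.IsHeegnerComponent j K ((d : ℚ) / 8)
            (GushelMukai.discriminantClass GushelMukai.vanishingLattice
              (GushelMukai.eStar + GushelMukai.fStar))) :=
  GushelMukai.IsMarking.isHeegnerComponent_of_isLabellingWithGram h₁ h₂ j hj
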